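/- Consider a discrete-time system $x^{+}=f(x,u)$ with $x\in\mathbb R^n$, $u=(u^1,u^2)\in\mathbb R^2$ and an equilibrium $(x_0,u_0)$, $f(x_0,u_0)=x_0$, where $f$ is smooth near $(x_0,u_0)$ with $\operatorname{rank}\partial_u f=2$ and $\operatorname{rank}\partial_{(x,u)}f=n$ at $(x_0,u_0)$. All assertions are local around the equilibrium. For a function $h(x,u)$ let $h_{[k]}(x,u,u_{[1]},\dots,u_{[k]})$ be its $k$-th forward shift along the system. Let $y=\varphi(x,u)$, $\varphi=(\varphi^1,\varphi^2)$ smooth, be a forward-flat output, i.e. for some $R_2=(r_{2,1},r_{2,2})\in\mathbb N^2$ there are smooth $F_x,F_u$ with $$x=F_x\big(y^j_{[k]}:\ 0\le k\le r_{2,j}-1,\ j=1,2\big),\qquad u=F_u\big(y^j_{[k]}:\ 0\le k\le r_{2,j},\ j=1,2\big),\qquad y^j_{[k]}=\varphi^j_{[k]},$$ locally around $(x_0,u_0,u_0,\dots)$, and let $R_2$ be the (componentwise) minimal such multi-index, $\#R_2=r_{2,1}+r_{2,2}$. Suppose that the equilibrium is regular in the following sense. (a) $\varphi^1$ has a relative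 degree $\rho_1\ge 0$ at $(x_0,u_0)$: for $k<\rho_1$ the function $\varphi^1_{[k]}$ does not depend on the inputs near the equilibrium, and $\partial_u\varphi^1_{[\rho_1]}(x_0,u_0)\neq 0$. (b) The derivative $\partial F_u/\partial y^2_{[r_{2,2}]}$ (which does not vanish identically near the equilibrium, by minimality) is nonzero at the equilibrium value of $y$. Then $d:=\#R_2-n=r_{2,1}-\rho_1$ is a nonnegative integer, and, after interchanging $u^1$ and $u^2$ if necessary, $\bar u^1=\varphi^1_{[\rho_1]}(x,u)$, $\bar u^2=u^2$ is an invertible input transformation around $(x_0,u_0)$, with a smooth inverse $u=\hat\Phi_u(x,\bar u)$. For each numbering of the inputs for which this transformation is invertible, the $d$-fold prolongation $$x^{+}=f\big(x,\hat\Phi_u(x,\bar u^1,\bar u^2)\big),\qquad \bar u^{1,+}=\bar u^1_{[1]},\ \dots,\ \bar u^{1,+}_{[d-1]}=\bar u^1_{[d]}$$ with state $(x,\bar u^1,\dots,\bar u^1_{[d-1]})$ and input $(\bar u^1_{[d]},\bar u^2)$ is static feedback linearizable around the equilibrium: there are a local diffeomorphism $\xi=T(z)$ of its state $z$ and a smooth,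 locally invertible static feedback $v=V(z,w)$ of its input $w$ that bring it to Brunovsky normal form $\xi^{j,+}_{1}=\xi^j_2,\ \dots,\ \xi^{j,+}_{\kappa_j}=v^j$ with $\kappa_j\ge1$, $j=1,2$. (For $d=0$ there is no shift chain and the transformed system itself is static feedback linearizable.) -/

import Mathlib

open scoped ContDiff Topology

noncomputable section

/-- `g` is smooth on a neighbourhood of `p`. -/
def SmoothNear {E F : Type*} [NormedAddCommGroup E] [NormedSpace ℝ E]
    [NormedAddCommGroup F] [NormedSpace ℝ F] (g : E → F) (p : E) : Prop :=
  ∀ᶠ q in 𝓝 p, ContDiffAt ℝ ∞ g q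

/-- `g` restricts to a diffeomorphism from a neighbourhood of `p` onto a neighbourhood of `g p`. -/
def IsLocalDiffeoNear {E F : Type*} [NormedAddCommGroup E] [NormedSpace ℝ E]
    [NormedAddCommGroup F] [NormedSpace ℝ F] (g : E → F) (p : E) : Prop :=
  SmoothNear g p ∧ ∃ h : F → E, SmoothNear h (g p) ∧
    (∀ᶠ q in 𝓝 p, h (g q) = q) ∧ (∀ᶠ r in 𝓝 (g p), g (h r) = r)

/-- Standing assumptions on a discrete-time system `x⁺ = f (x, u)` near `(x₀, u₀)`. -/
structure IsDiscreteSystem {n m : ℕ} (f : (Fin n → ℝ) × (Fin m → ℝ) → (Fin n → ℝ))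
    (x₀ : Fin n → ℝ) (u₀ : Fin m → ℝ) : Prop where
  smooth : SmoothNear f (x₀, u₀)
  equilibrium : f (x₀, u₀) = x₀
  /-- `rank ∂f/∂u = m`: the inputs are independent. -/
  independent_inputs : Function.Injective (fderiv ℝ (fun u => f (x₀, u)) u₀)
  /-- `rank ∂f/∂(x, u) = n`. -/
  submersive : Function.Surjective (fderiv ℝ f (x₀, u₀))

/-- The state after `k` steps, from the state `x` under the inputs `v 0, v 1, …`. -/
def stateAt {X U : Type*} (f : X × U → X) (x : X) (v : ℕ → U) : ℕ → X
  | 0 => x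
  | k + 1 => f (stateAt f x v k, v k)

/-- The `k`-th forward shift `h_[k]` of a function `h (x, u)`, as a function of `x` and of
`v = (u, u_[1], u_[2], …)`; it involves only `v 0, …, v k`. -/
def forwardShift {X U Y : Type*} (f : X × U → X) (h : X × U → Y) (k : ℕ) (x : X) (v : ℕ → U) : Y :=
  h (stateAt f x v k, v k)

/-- The forward shifts of orders `0, …, N j - 1` of the components `y j = φ j (x, u)`. -/
def outputJet {n m : ℕ} (f : (Fin n → ℝ) × (Fin m → ℝ) → (Fin n → ℝ))
    (φ : (Fin n → ℝ) × (Fin m → ℝ) → (Fin m → ℝ)) (N : Fin m → ℕ)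
    (x : Fin n → ℝ) (v : ℕ → Fin m → ℝ) : (j : Fin m) → Fin (N j) → ℝ :=
  fun j k => forwardShift f (fun p => φ p j) k x v

/-- `x = Fx (y_[0, R-1])` and `u = Fu (y_[0, R])` hold locally, for smooth `Fx`, `Fu`. The
neighbourhood is taken in the space with coordinates `(x, u, u_[1], u_[2], …)` with the product
topology, so it restricts finitely many coordinates only. -/
structure IsParametrization {n m : ℕ} (f : (Fin n → ℝ) × (Fin m → ℝ) → (Fin n → ℝ))
    (x₀ : Fin n → ℝ) (u₀ : Fin m → ℝ) (φ : (Fin n → ℝ) × (Fin m → ℝ) → (Fin m → ℝ))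
    (R : Fin m → ℕ) (Fx : ((j : Fin m) → Fin (R j) → ℝ) → (Fin n → ℝ))
    (Fu : ((j : Fin m) → Fin (R j + 1) → ℝ) → (Fin m → ℝ)) : Prop where
  smooth_x : SmoothNear Fx (fun j _ => φ (x₀, u₀) j)
  smooth_u : SmoothNear Fu (fun j _ => φ (x₀, u₀) j)
  state_eq : ∀ᶠ p : (Fin n → ℝ) × (ℕ → Fin m → ℝ) in 𝓝 (x₀, fun _ => u₀),
    Fx (outputJet f φ R p.1 p.2) = p.1
  input_eq : ∀ᶠ p : (Fin n → ℝ) × (ℕ → Fin m → ℝ) in 𝓝 (x₀, fun _ => u₀),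
    Fu (outputJet f φ (fun j => R j + 1) p.1 p.2) = p.2 0

/-- `R` is admissible if `x` and `u` can be expressed by `y_[0, R-1]` and `y_[0, R]`. -/
def shiftOrders {n m : ℕ} (f : (Fin n → ℝ) × (Fin m → ℝ) → (Fin n → ℝ))
    (x₀ : Fin n → ℝ) (u₀ : Fin m → ℝ) (φ : (Fin n → ℝ) × (Fin m → ℝ) → (Fin m → ℝ)) :
    Set (Fin m → ℕ) :=
  {R | ∃ Fx Fu, IsParametrization f x₀ u₀ φ R Fx Fu}

/-- `y = φ (x, u)` is a forward-flat output of `x⁺ = f (x, u)` around `(x₀, u₀)`. -/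
def IsForwardFlatOutput {n m : ℕ} (f : (Fin n → ℝ) × (Fin m → ℝ) → (Fin n → ℝ))
    (x₀ : Fin n → ℝ) (u₀ : Fin m → ℝ) (φ : (Fin n → ℝ) × (Fin m → ℝ) → (Fin m → ℝ)) : Prop :=
  SmoothNear φ (x₀, u₀) ∧ (shiftOrders f x₀ u₀ φ).Nonempty

/-- The `k`-th forward shift of `h` as a function of `(x, u)`, with all later inputs frozen at
`u₀`. When `h` has relative degree `k`, its `k`-th forward shift does not involve the later inputs
near the equilibrium, so that this is then the function `h_[k] (x, u)` itself. -/
def shiftOfInput {X U Y : Type*} (f : X × U → X) (u₀ : U) (h : X × U → Y) (k : ℕ) (p : X × U) : Y :=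
  forwardShift f h k p.1 (fun i => if i = 0 then p.2 else u₀)

/-- `h (x, u)` has relative degree `ρ` at `(x₀, u₀)`: its forward shifts of order less than `ρ`
do not depend on the input near the equilibrium, and `∂h_[ρ]/∂u ≠ 0` at the equilibrium. -/
def HasRelativeDegree {n m : ℕ} (f : (Fin n → ℝ) × (Fin m → ℝ) → (Fin n → ℝ))
    (x₀ : Fin n → ℝ) (u₀ : Fin m → ℝ) (h : (Fin n → ℝ) × (Fin m → ℝ) → ℝ) (ρ : ℕ) : Prop :=
  (∀ k < ρ, ∀ᶠ p : (Fin n → ℝ) × (ℕ → Fin m → ℝ) in 𝓝 (x₀, fun _ => u₀),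
    forwardShift f h k p.1 p.2 = forwardShift f h k p.1 (fun _ => u₀)) ∧
  fderiv ℝ (fun u => shiftOfInput f u₀ h ρ (x₀, u)) u₀ ≠ 0

/-- `ū = Ψ (x, u)` is an invertible input transformation around `(x₀, u₀)`, with inverse
`u = Φ (x, ū)`. -/
structure IsInputTransformation {n m : ℕ} (x₀ : Fin n → ℝ) (u₀ : Fin m → ℝ)
    (Ψ Φ : (Fin n → ℝ) × (Fin m → ℝ) → (Fin m → ℝ)) : Prop where
  smooth : SmoothNear Ψ (x₀, u₀)
  smooth_inv : SmoothNear Φ (x₀, Ψ (x₀, u₀))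
  left_inv : ∀ᶠ p in 𝓝 (x₀, u₀), Φ (p.1, Ψ p) = p.2
  right_inv : ∀ᶠ q in 𝓝 (x₀, Ψ (x₀, u₀)), Ψ (q.1, Φ q) = q.2

/-- The `d`-fold prolongation of `ū¹`: the state is `(x, (ū¹, ū¹_[1], …, ū¹_[d-1]))`, the input is
`w = (ū¹_[d], ū²)`, and `η = (ū¹, ū¹_[1], …, ū¹_[d])`. -/
def prolongation {n : ℕ} (f : (Fin n → ℝ) × (Fin 2 → ℝ) → (Fin n → ℝ))
    (Φ : (Fin n → ℝ) × (Fin 2 → ℝ) → (Fin 2 → ℝ)) (d : ℕ)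
    (p : ((Fin n → ℝ) × (Fin d → ℝ)) × (Fin 2 → ℝ)) : (Fin n → ℝ) × (Fin d → ℝ) :=
  let x := p.1.1
  let w := p.2
  let η : Fin (d + 1) → ℝ := Fin.snoc (α := fun _ => ℝ) p.1.2 (w 0)
  (f (x, Φ (x, ![η 0, w 1])), fun k => η k.succ)

/-- The Brunovsky normal form with chains of lengths `κ j`: each chain is a shift register that is
fed by the input `v j` at its end. -/
def brunovsky {m : ℕ} (κ : Fin m → ℕ) (ξ : (j : Fin m) → Fin (κ j) → ℝ) (v : Fin m → ℝ) :
    (j : Fin m) → Fin (κ j) → ℝ :=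
  fun j k => if h : (k : ℕ) + 1 < κ j then ξ j ⟨k + 1, h⟩ else v j

/-- `z⁺ = g (z, w)` is static feedback linearizable around `(z₀, w₀)`: a local change `ξ = T z` of
the state and a locally invertible static feedback `v = V (z, w)` bring it to Brunovsky form. -/
def IsStaticFeedbackLinearizable {Z : Type*} [NormedAddCommGroup Z] [NormedSpace ℝ Z] {m : ℕ}
    (g : Z × (Fin m → ℝ) → Z) (z₀ : Z) (w₀ : Fin m → ℝ) : Prop :=
  ∃ κ : Fin m → ℕ, (∀ j, 0 < κ j) ∧
    ∃ (T : Z → (j : Fin m) → Fin (κ j) → ℝ) (V : Z × (Fin m → ℝ) → (Fin m → ℝ)),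
      IsLocalDiffeoNear T z₀ ∧
      IsLocalDiffeoNear (fun p : Z × (Fin m → ℝ) => (T p.1, V p)) (z₀, w₀) ∧
      ∀ᶠ p in 𝓝 (z₀, w₀), T (g p) = brunovsky κ (T p.1) (V p)

/-- The input transformation `ū¹ = φ¹_[ρ] (x, u)`, `ū² = uⁱ`. -/
def outputInputMap {n : ℕ} (f : (Fin n → ℝ) × (Fin 2 → ℝ) → (Fin n → ℝ)) (u₀ : Fin 2 → ℝ)
    (φ : (Fin n → ℝ) × (Fin 2 → ℝ) → (Fin 2 → ℝ)) (ρ : ℕ) (i : Fin 2)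
    (p : (Fin n → ℝ) × (Fin 2 → ℝ)) : Fin 2 → ℝ :=
  ![shiftOfInput f u₀ (fun q => φ q 0) ρ p, p.2 i]

end

/-! The core fact is that the shifts of a flat output up to the orders `R` are free: every jet near
the equilibrium jet occurs along a trajectory near the equilibrium. For the linearization this is a
dimension count (`forwardShift_surjective_of_reconstructible`). There are as many outputs as inputs,
and the input is determined by the output shifts of orders up to `r`; a linear relation among `K`
consecutive output values would recur in every window of length `K` and leave too little room to
encode all inputs. Hence the jet map is a submersion, and an identity that holds along trajectories
becomes an identity in independent variables (`IsParametrization.eventually_jet`). In these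
variables the system is a shift: `Fx (jetTail q) = f (Fx (jetInit q), Fu q)`.

The relative degree identifies `ū¹_[l]` with `y¹_[ρ+l]`. So the state of the prolongation is a
function `prolongedState` of the shifts below the orders `R`, its input `prolongedControl` is
`(y¹_[R 0], uⁱ)`, and the prolongation acts on jets as a shift (`prolongation_jet`). By the
regularity in `y²`, the input `uⁱ` can replace the coordinate `y²_[R 1]` (`fderiv_input_ne_zero`),
so the lower jet and the new input are again independent (`eventually_init_control`).

The local inverse of `prolongedState` is explicit: run the prolongation with its input frozen at the
equilibrium value and record the outputs (`closedLoopJet`). Independence is what makes freezing the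
input harmless. This diffeomorphism yields the dimension formula and serves as `T`; the feedback `V`
reads off the ends of the chains one step later. -/

/-! ### Trajectories and forward shifts -/

section Trajectories

variable {X U Y : Type*}

theorem stateAt_add (f : X × U → X) (x : X) (v : ℕ → U) (k l : ℕ) :
    stateAt f x v (k + l) = stateAt f (stateAt f x v k) (fun i => v (k + i)) l := by
  induction l with
  | zero => rfl
  | succ l ih => rw [← add_assoc, stateAt, stateAt, ih]

theorem forwardShift_add (f : X × U → X) (h : X × U → Y) (x : X) (v : ℕ → U) (k l : ℕ) :
    forwardShift f h (k + l) x v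
      = forwardShift f h l (stateAt f x v k) (fun i => v (k + i)) := by
  simp only [forwardShift, stateAt_add]

theorem forwardShift_succ (f : X × U → X) (h : X × U → Y) (x : X) (v : ℕ → U) (k : ℕ) :
    forwardShift f h (k + 1) x v = forwardShift f h k (f (x, v 0)) (fun i => v (i + 1)) := by
  rw [add_comm, forwardShift_add]
  simp only [stateAt, add_comm]

theorem stateAt_congr (f : X × U → X) (x : X) {v v' : ℕ → U} {k : ℕ}
    (h : ∀ i < k, v i = v' i) : stateAt f x v k = stateAt f x v' k := by
  induction k with
  | zero => rfl
  | succ k ih =>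
    rw [stateAt, stateAt, ih fun i hi => h i (hi.trans k.lt_succ_self), h k k.lt_succ_self]

theorem forwardShift_congr (f : X × U → X) (g : X × U → Y) (x : X) {v v' : ℕ → U} {k : ℕ}
    (h : ∀ i ≤ k, v i = v' i) : forwardShift f g k x v = forwardShift f g k x v' := by
  rw [forwardShift, forwardShift, stateAt_congr f x fun i hi => h i hi.le, h k le_rfl]

theorem stateAt_equilibrium {f : X × U → X} {x : X} {u : U} (h : f (x, u) = x) (k : ℕ) :
    stateAt f x (fun _ => u) k = x := by
  induction k with
  | zero => rfl
  | succ k ih => rw [stateAt, ih, h]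

theorem forwardShift_equilibrium {f : X × U → X} {x : X} {u : U} (h : f (x, u) = x)
    (g : X × U → Y) (k : ℕ) : forwardShift f g k x (fun _ => u) = g (x, u) := by
  rw [forwardShift, stateAt_equilibrium h]

end Trajectories

/-! ### Freeness of the output of a reconstructible linear system -/

section LinearSystems

variable {X U Y : Type*} [AddCommGroup X] [Module ℝ X] [AddCommGroup U] [Module ℝ U]
  [AddCommGroup Y] [Module ℝ Y]

/-- The state of a linear system after `k` steps, as a linear map. -/
def stateAtLinear (A : X × U →ₗ[ℝ] X) : ℕ → X × (ℕ → U) →ₗ[ℝ] X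
  | 0 => LinearMap.fst ℝ X (ℕ → U)
  | k + 1 => A ∘ₗ (stateAtLinear A k).prod (LinearMap.proj k ∘ₗ LinearMap.snd ℝ X (ℕ → U))

theorem stateAtLinear_apply (A : X × U →ₗ[ℝ] X) (k : ℕ) (p : X × (ℕ → U)) :
    stateAtLinear A k p = stateAt A p.1 p.2 k := by
  induction k with
  | zero => rfl
  | succ k ih => simp [stateAtLinear, stateAt, ih]

/-- The forward shifts of the output of a linear system, as linear maps. -/
def forwardShiftLinear (A : X × U →ₗ[ℝ] X) (C : X × U →ₗ[ℝ] Y) (k : ℕ) :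
    X × (ℕ → U) →ₗ[ℝ] Y :=
  C ∘ₗ (stateAtLinear A k).prod (LinearMap.proj k ∘ₗ LinearMap.snd ℝ X (ℕ → U))

theorem forwardShiftLinear_apply (A : X × U →ₗ[ℝ] X) (C : X × U →ₗ[ℝ] Y) (k : ℕ)
    (p : X × (ℕ → U)) : forwardShiftLinear A C k p = forwardShift A C k p.1 p.2 := by
  simp [forwardShiftLinear, forwardShift, stateAtLinear_apply]

/-- If a linear system with as many outputs as inputs admits the reconstruction of its input from
finitely many shifts of its output, then its output trajectories are unconstrained. -/
theorem forwardShift_surjective_of_reconstructible [FiniteDimensional ℝ U] [FiniteDimensional ℝ Y]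
    (hUY : Module.finrank ℝ U = Module.finrank ℝ Y)
    (A : X × U →ₗ[ℝ] X) (C : X × U →ₗ[ℝ] Y) (r : ℕ)
    (hr : ∀ x v, (∀ k ≤ r, forwardShift A C k x v = 0) → v 0 = 0) (K : ℕ) (t : Fin K → Y) :
    ∃ x v, ∀ k : Fin K, forwardShift A C k x v = t k := by
  let Λ : X × (ℕ → U) →ₗ[ℝ] (Fin K → Y) := LinearMap.pi fun k => forwardShiftLinear A C k
  suffices h : LinearMap.range Λ = ⊤ by
    obtain ⟨p, hp⟩ := LinearMap.range_eq_top.1 h t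
    exact ⟨p.1, p.2, fun k => by rw [← forwardShiftLinear_apply A C k p, ← hp]; rfl⟩
  by_contra hne
  have hlt : Module.finrank ℝ (LinearMap.range Λ) < K * Module.finrank ℝ Y := by
    have := Submodule.finrank_lt hne
    rwa [Module.finrank_pi_fintype, Finset.sum_const, Finset.card_univ, Fintype.card_fin,
      smul_eq_mul] at this
  set m := Module.finrank ℝ Y
  -- A proper range loses at least one dimension in each of the `q` windows, while cutting `r` steps
  -- off the input loses only `m * r` dimensions. One window more than `m * r` gives the
  -- contradiction.
  set q := m * r + 1 with hq
  -- inputs supported on `[0, q K - r)`, extended by zero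
  let ext : (Fin (q * K - r) → U) →ₗ[ℝ] (ℕ → U) := LinearMap.pi fun i =>
    if h : i < q * K - r then LinearMap.proj ⟨i, h⟩ else 0
  -- The output is cut into `q` windows of length `K`. Each window is an output of the same system,
  -- started at the state reached at time `b * K`, so it lies in the range of `Λ`.
  let B : (Fin (q * K - r) → U) →ₗ[ℝ] (Fin q → LinearMap.range Λ) := LinearMap.pi fun b =>
    Λ.rangeRestrict ∘ₗ (stateAtLinear A (b * K) ∘ₗ LinearMap.inr ℝ X (ℕ → U) ∘ₗ ext).prod
      (LinearMap.funLeft ℝ U (fun i => b * K + i) ∘ₗ ext)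
  have hB : Function.Injective B := by
    rw [← LinearMap.ker_eq_bot, LinearMap.ker_eq_bot']
    intro w hw
    have h0 : ∀ k < q * K, forwardShift A C k 0 (ext w) = 0 := by
      intro k hk
      have hK : 0 < K := Nat.pos_of_ne_zero fun h => by simp [h] at hk
      have hb : k / K < q := (Nat.div_lt_iff_lt_mul hK).2 hk
      have h1 := congrFun (congrArg Subtype.val (congrFun hw ⟨k / K, hb⟩)) ⟨k % K, Nat.mod_lt k hK⟩
      have h2 : forwardShiftLinear A C (k % K)
        (stateAtLinear A (k / K * K) (0, ext w), fun i => ext w (k / K * K + i)) = 0 := h1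
      rw [forwardShiftLinear_apply, stateAtLinear_apply] at h2
      simp only at h2
      rw [← forwardShift_add, Nat.div_add_mod'] at h2
      exact h2
    -- The input at time `i` is reconstructed from the outputs at times `i, …, i + r`; these stay
    -- below `q * K` because the input window ends `r` steps early.
    funext i
    have h1 := hr (stateAt A 0 (ext w) i) (fun l => ext w (i + l)) fun k hk => by
      rw [← forwardShift_add]
      exact h0 _ (by have := i.2; omega)
    simpa [ext] using h1
  have hle := LinearMap.finrank_le_finrank_of_injective hB
  rw [Module.finrank_pi_fintype, Module.finrank_pi_fintype, Finset.sum_const, Finset.sum_const,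
    Finset.card_univ, Finset.card_univ, Fintype.card_fin, Fintype.card_fin, smul_eq_mul,
    smul_eq_mul, hUY] at hle
  have h1 : q * K * m ≤ (q * K - r) * m + r * m := by
    rw [← add_mul]
    exact Nat.mul_le_mul_right _ (by omega)
  have h2 : q * (Module.finrank ℝ (LinearMap.range Λ) + 1) ≤ q * (K * m) :=
    Nat.mul_le_mul_left _ hlt
  nlinarith

end LinearSystems

/-! ### Linearization of trajectories at the equilibrium -/

section Derivatives

variable {P X U Y : Type*} [NormedAddCommGroup P] [NormedSpace ℝ P]
  [NormedAddCommGroup X] [NormedSpace ℝ X] [NormedAddCommGroup U] [NormedSpace ℝ U]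
  [NormedAddCommGroup Y] [NormedSpace ℝ Y]

/-- The linearization of a trajectory at an equilibrium is a trajectory of the linearization. -/
theorem exists_hasStrictFDerivAt_stateAt {f : X × U → X} {x₀ : X} {u₀ : U}
    {A : X × U →L[ℝ] X} (hf : HasStrictFDerivAt f A (x₀, u₀)) (hfix : f (x₀, u₀) = x₀)
    {x : P → X} {v : ℕ → P → U} {p₀ : P} {x' : P →L[ℝ] X} {v' : ℕ → P →L[ℝ] U}
    (hx : HasStrictFDerivAt x x' p₀) (hv : ∀ i, HasStrictFDerivAt (v i) (v' i) p₀)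
    (hx₀ : x p₀ = x₀) (hv₀ : ∀ i, v i p₀ = u₀) (k : ℕ) :
    ∃ L : P →L[ℝ] X, HasStrictFDerivAt (fun p => stateAt f (x p) (fun i => v i p) k) L p₀ ∧
      ∀ δ, L δ = stateAt A (x' δ) (fun i => v' i δ) k := by
  induction k with
  | zero => exact ⟨x', hx, fun _ => rfl⟩
  | succ k ih =>
    obtain ⟨L, hL, hL'⟩ := ih
    have hk : stateAt f (x p₀) (fun i => v i p₀) k = x₀ := by
      simp only [hx₀, hv₀]; exact stateAt_equilibrium hfix k
    refine ⟨A.comp (L.prod (v' k)), ?_, fun δ => by simp [stateAt, hL']⟩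
    exact HasStrictFDerivAt.comp (g := f) p₀ (by beta_reduce; rw [hk, hv₀]; exact hf)
      (hL.prodMk (hv k))

theorem exists_hasStrictFDerivAt_forwardShift {f : X × U → X} {h : X × U → Y} {x₀ : X} {u₀ : U}
    {A : X × U →L[ℝ] X} {C : X × U →L[ℝ] Y} (hf : HasStrictFDerivAt f A (x₀, u₀))
    (hh : HasStrictFDerivAt h C (x₀, u₀)) (hfix : f (x₀, u₀) = x₀)
    {x : P → X} {v : ℕ → P → U} {p₀ : P} {x' : P →L[ℝ] X} {v' : ℕ → P →L[ℝ] U}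
    (hx : HasStrictFDerivAt x x' p₀) (hv : ∀ i, HasStrictFDerivAt (v i) (v' i) p₀)
    (hx₀ : x p₀ = x₀) (hv₀ : ∀ i, v i p₀ = u₀) (k : ℕ) :
    ∃ L : P →L[ℝ] Y, HasStrictFDerivAt (fun p => forwardShift f h k (x p) (fun i => v i p)) L p₀ ∧
      ∀ δ, L δ = forwardShift A C k (x' δ) (fun i => v' i δ) := by
  obtain ⟨L, hL, hL'⟩ := exists_hasStrictFDerivAt_stateAt hf hfix hx hv hx₀ hv₀ k
  have hk : stateAt f (x p₀) (fun i => v i p₀) k = x₀ := by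
    simp only [hx₀, hv₀]; exact stateAt_equilibrium hfix k
  refine ⟨C.comp (L.prod (v' k)), ?_, fun δ => by simp [forwardShift, hL']⟩
  exact HasStrictFDerivAt.comp (g := h) p₀ (by beta_reduce; rw [hk, hv₀]; exact hh) (hL.prodMk (hv k))

end Derivatives

/-! ### Smoothness near a point and local diffeomorphisms -/

section Smoothness

variable {E F G : Type*} [NormedAddCommGroup E] [NormedSpace ℝ E]
  [NormedAddCommGroup F] [NormedSpace ℝ F] [NormedAddCommGroup G] [NormedSpace ℝ G]

theorem SmoothNear.contDiffAt {g : E → F} {p : E} (hg : SmoothNear g p) : ContDiffAt ℝ ∞ g p :=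
  hg.self_of_nhds

theorem SmoothNear.continuousAt {g : E → F} {p : E} (hg : SmoothNear g p) : ContinuousAt g p :=
  hg.contDiffAt.continuousAt

theorem SmoothNear.hasStrictFDerivAt {g : E → F} {p : E} (hg : SmoothNear g p) :
    HasStrictFDerivAt g (fderiv ℝ g p) p :=
  hg.contDiffAt.hasStrictFDerivAt (by simp)

theorem ContDiff.smoothNear {g : E → F} (hg : ContDiff ℝ ∞ g) (p : E) : SmoothNear g p :=
  Filter.Eventually.of_forall fun _ => hg.contDiffAt

theorem SmoothNear.comp {g : F → G} {h : E → F} {p : E} {r : F} (hg : SmoothNear g r)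
    (hh : SmoothNear h p) (hr : h p = r) : SmoothNear (fun q => g (h q)) p := by
  subst hr
  filter_upwards [hh, hh.continuousAt.eventually hg] with q h1 h2
  exact h2.comp q h1

theorem SmoothNear.prodMk {g : E → F} {h : E → G} {p : E} (hg : SmoothNear g p)
    (hh : SmoothNear h p) : SmoothNear (fun q => (g q, h q)) p := by
  filter_upwards [hg, hh] with q h1 h2 using h1.prodMk h2

theorem SmoothNear.pi {ι : Type*} [Fintype ι] {F : ι → Type*} [∀ i, NormedAddCommGroup (F i)]
    [∀ i, NormedSpace ℝ (F i)] {g : E → ∀ i, F i} {p : E}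
    (hg : ∀ i, SmoothNear (fun q => g q i) p) : SmoothNear g p := by
  filter_upwards [Filter.eventually_all.2 hg] with q hq using contDiffAt_pi.2 hq

theorem smoothNear_stateAt {X U : Type*} [NormedAddCommGroup X] [NormedSpace ℝ X]
    [NormedAddCommGroup U] [NormedSpace ℝ U] {f : X × U → X} {x₀ : X} {u₀ : U}
    (hf : SmoothNear f (x₀, u₀)) (hfix : f (x₀, u₀) = x₀) {x : E → X} {v : ℕ → E → U} {p : E}
    (hx : SmoothNear x p) (hv : ∀ i, SmoothNear (v i) p)
    (hx₀ : x p = x₀) (hv₀ : ∀ i, v i p = u₀) (k : ℕ) :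
    SmoothNear (fun q => stateAt f (x q) (fun i => v i q) k) p := by
  induction k with
  | zero => exact hx
  | succ k ih =>
    refine hf.comp (ih.prodMk (hv k)) ?_
    simp only [hx₀, hv₀, stateAt_equilibrium hfix]

theorem smoothNear_forwardShift {X U : Type*} [NormedAddCommGroup X] [NormedSpace ℝ X]
    [NormedAddCommGroup U] [NormedSpace ℝ U] {f : X × U → X} {h : X × U → F} {x₀ : X} {u₀ : U}
    (hf : SmoothNear f (x₀, u₀)) (hh : SmoothNear h (x₀, u₀)) (hfix : f (x₀, u₀) = x₀)
    {x : E → X} {v : ℕ → E → U} {p : E} (hx : SmoothNear x p) (hv : ∀ i, SmoothNear (v i) p)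
    (hx₀ : x p = x₀) (hv₀ : ∀ i, v i p = u₀) (k : ℕ) :
    SmoothNear (fun q => forwardShift f h k (x q) (fun i => v i q)) p := by
  refine hh.comp ((smoothNear_stateAt hf hfix hx hv hx₀ hv₀ k).prodMk (hv k)) ?_
  simp only [hx₀, hv₀, stateAt_equilibrium hfix]

/-- The inverse function theorem for maps that are smooth near a point. -/
theorem SmoothNear.isLocalDiffeoNear [CompleteSpace E] [CompleteSpace F] {g : E → F} {p : E}
    (hg : SmoothNear g p) (hbij : Function.Bijective (fderiv ℝ g p)) : IsLocalDiffeoNear g p := by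
  let e : E ≃L[ℝ] F := ContinuousLinearEquiv.ofBijective (fderiv ℝ g p)
    (LinearMap.ker_eq_bot.2 hbij.1) (LinearMap.range_eq_top.2 hbij.2)
  have he : HasFDerivAt g (e : E →L[ℝ] F) p := hg.hasStrictFDerivAt.hasFDerivAt
  have hs : HasStrictFDerivAt g (e : E →L[ℝ] F) p := hg.hasStrictFDerivAt
  let H := hg.contDiffAt.toOpenPartialHomeomorph g he (by simp)
  have hp : p ∈ H.source := hg.contDiffAt.mem_toOpenPartialHomeomorph_source he (by simp)
  have hH : ∀ q, H q = g q := fun q => rfl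
  have hinv : H.symm (g p) = p := H.left_inv hp
  have hgp : g p ∈ H.target := H.map_source hp
  refine ⟨hg, H.symm, ?_, ?_, ?_⟩
  · have hcont : ContinuousAt (fderiv ℝ g) p :=
      (hg.contDiffAt.fderiv_right (m := 0) (by simp)).continuousAt
    have hequiv : ∀ᶠ q in 𝓝 p, fderiv ℝ g q ∈ Set.range ((↑) : (E ≃L[ℝ] F) → E →L[ℝ] F) :=
      hcont.eventually (ContinuousLinearEquiv.nhds e)
    have hsymm : Filter.Tendsto H.symm (𝓝 (g p)) (𝓝 p) := by
      have := H.continuousAt_symm hgp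
      rwa [ContinuousAt, hinv] at this
    filter_upwards [hsymm.eventually hequiv, hsymm.eventually hg, H.open_target.mem_nhds hgp]
      with r h1 h2 h3
    obtain ⟨e', he'⟩ := h1
    refine H.contDiffAt_symm (f₀' := e') h3 ?_ h2
    rw [he']
    exact (h2.hasStrictFDerivAt (by simp)).hasFDerivAt
  · filter_upwards [H.open_source.mem_nhds hp] with q hq using H.left_inv hq
  · filter_upwards [H.open_target.mem_nhds hgp] with r hr using H.right_inv hr

/-- A smooth map between spaces of the same finite dimension that has a smooth left inverse is a
local diffeomorphism, and so is the left inverse. -/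
theorem isLocalDiffeoNear_of_leftInverse [FiniteDimensional ℝ E] [FiniteDimensional ℝ F]
    (hdim : Module.finrank ℝ E = Module.finrank ℝ F) {g : E → F} {h : F → E} {p : E} {r : F}
    (hg : SmoothNear g p) (hh : SmoothNear h r) (hr : g p = r)
    (hinv : ∀ᶠ q in 𝓝 p, h (g q) = q) :
    IsLocalDiffeoNear h r ∧ ∀ᶠ s in 𝓝 r, g (h s) = s := by
  have := FiniteDimensional.complete ℝ E
  have := FiniteDimensional.complete ℝ F
  subst hr
  have hcomp : (fderiv ℝ h (g p)).comp (fderiv ℝ g p) = ContinuousLinearMap.id ℝ E := by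
    have h1 := hh.hasStrictFDerivAt.hasFDerivAt.comp p hg.hasStrictFDerivAt.hasFDerivAt
    exact h1.unique ((hasFDerivAt_id p).congr_of_eventuallyEq hinv)
  have hsurj : Function.Surjective (fderiv ℝ h (g p)) := fun x =>
    ⟨fderiv ℝ g p x, DFunLike.congr_fun hcomp x⟩
  have hdiff := hh.isLocalDiffeoNear ⟨(LinearMap.injective_iff_surjective_of_finrank_eq_finrank
    (f := (fderiv ℝ h (g p)).toLinearMap) hdim.symm).2 hsurj, hsurj⟩
  refine ⟨hdiff, ?_⟩
  obtain ⟨-, k, hk, hkh, -⟩ := hdiff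
  have hp : h (g p) = p := hinv.self_of_nhds
  -- A right inverse of the now locally invertible `h` must agree with its local inverse `k`, so it
  -- is a two-sided inverse.
  have hgk : ∀ᶠ q in 𝓝 p, g q = k q := by
    filter_upwards [hinv, hg.continuousAt.eventually hkh] with q h1 h2
    rw [← h2, h1]
  have hht : Filter.Tendsto h (𝓝 (g p)) (𝓝 p) := by
    simpa only [ContinuousAt, hp] using hh.continuousAt
  filter_upwards [hht.eventually hgk, hkh] with s h1 h2
  rw [h1, h2]

theorem IsLocalDiffeoNear.finrank_eq {g : E → F} {p : E}
    (hg : IsLocalDiffeoNear g p) : Module.finrank ℝ E = Module.finrank ℝ F := by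
  obtain ⟨hs, h, hh, h1, h2⟩ := hg
  have hp : h (g p) = p := h1.self_of_nhds
  have hs' := hs.hasStrictFDerivAt.hasFDerivAt
  have hh' := hh.hasStrictFDerivAt.hasFDerivAt
  have h3 : (fderiv ℝ h (g p)).comp (fderiv ℝ g p) = ContinuousLinearMap.id ℝ E :=
    (hh'.comp p hs').unique ((hasFDerivAt_id p).congr_of_eventuallyEq h1)
  have h4 : (fderiv ℝ g p).comp (fderiv ℝ h (g p)) = ContinuousLinearMap.id ℝ F := by
    refine HasFDerivAt.unique (f := g ∘ h) (x := g p) ?_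
      ((hasFDerivAt_id (g p)).congr_of_eventuallyEq h2)
    refine HasFDerivAt.comp (g p) ?_ hh'
    rwa [hp]
  exact LinearEquiv.finrank_eq (LinearEquiv.ofLinearMap (fderiv ℝ g p).toLinearMap
    (fderiv ℝ h (g p)).toLinearMap (LinearMap.ext fun x => DFunLike.congr_fun h4 x)
    (LinearMap.ext fun x => DFunLike.congr_fun h3 x))

end Smoothness

/-! ### Flat parametrizations and the freeness of jets -/

section Parametrization

variable {n m : ℕ} {f : (Fin n → ℝ) × (Fin m → ℝ) → (Fin n → ℝ)}
  {x₀ : Fin n → ℝ} {u₀ : Fin m → ℝ} {φ : (Fin n → ℝ) × (Fin m → ℝ) → (Fin m → ℝ)}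
  {R : Fin m → ℕ} {Fx : ((j : Fin m) → Fin (R j) → ℝ) → (Fin n → ℝ)}
  {Fu : ((j : Fin m) → Fin (R j + 1) → ℝ) → (Fin m → ℝ)}

theorem outputJet_equilibrium (hfix : f (x₀, u₀) = x₀) (N : Fin m → ℕ) :
    outputJet f φ N x₀ (fun _ => u₀) = fun j _ => φ (x₀, u₀) j := by
  funext j k
  exact forwardShift_equilibrium hfix _ _

/-- The linearization of the reconstruction `u = Fu (y_[0, R])`. -/
theorem IsParametrization.linearized_input_eq (hf : IsDiscreteSystem f x₀ u₀)
    (hφ : SmoothNear φ (x₀, u₀)) (hF : IsParametrization f x₀ u₀ φ R Fx Fu)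
    (x : Fin n → ℝ) (v : ℕ → Fin m → ℝ)
    (h0 : ∀ j, ∀ k ≤ R j,
      forwardShift (fderiv ℝ f (x₀, u₀)) (fderiv ℝ φ (x₀, u₀)) k x v j = 0) : v 0 = 0 := by
  -- Both sides of the reconstruction are differentiated along a line of initial states and inputs:
  -- the jet has derivative zero, the first input has derivative `v 0`.
  let γx : ℝ → Fin n → ℝ := fun t => x₀ + t • x
  let γv : ℕ → ℝ → Fin m → ℝ := fun i t => u₀ + t • v i
  have hline : ∀ {l : ℕ} (a b : Fin l → ℝ), HasStrictFDerivAt (fun t : ℝ => a + t • b)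
      ((ContinuousLinearMap.id ℝ ℝ).smulRight b) 0 := fun a b =>
    ((ContinuousLinearMap.id ℝ ℝ).smulRight b).hasStrictFDerivAt.const_add a
  have hjet : HasStrictFDerivAt
      (fun t => outputJet f φ (fun j => R j + 1) (γx t) (fun i => γv i t)) (0 : ℝ →L[ℝ] _) 0 := by
    rw [hasStrictFDerivAt_pi']
    intro j
    rw [hasStrictFDerivAt_pi']
    intro k
    obtain ⟨L, hL, hL'⟩ := exists_hasStrictFDerivAt_forwardShift hf.smooth.hasStrictFDerivAt
      hφ.hasStrictFDerivAt hf.equilibrium (hline x₀ x) (fun i => hline u₀ (v i)) (by simp)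
      (by simp) k
    have h1 := (hasStrictFDerivAt_pi'.1 hL) j
    refine HasStrictFDerivAt.congr_fderiv h1 ?_
    ext
    have := congrFun (hL' 1) j
    simp only [ContinuousLinearMap.smulRight_apply, ContinuousLinearMap.id_apply, one_smul] at this
    simpa [this] using h0 j k (Nat.lt_succ_iff.1 k.2)
  have hbase : outputJet f φ (fun j => R j + 1) (γx 0) (fun i => γv i 0)
      = fun j _ => φ (x₀, u₀) j := by
    simp only [γx, γv, zero_smul, add_zero]
    exact outputJet_equilibrium hf.equilibrium _
  have hFu : HasStrictFDerivAt Fu (fderiv ℝ Fu fun j _ => φ (x₀, u₀) j)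
      (outputJet f φ (fun j => R j + 1) (γx 0) (fun i => γv i 0)) := by
    rw [hbase]; exact hF.smooth_u.hasStrictFDerivAt
  have hcomp := (hFu.comp 0 hjet).hasFDerivAt
  have hcurve : Filter.Tendsto (fun t => (γx t, fun i => γv i t)) (𝓝 0)
      (𝓝 (x₀, fun _ => u₀)) := by
    have hc : Continuous (fun t => (γx t, fun i => γv i t)) := by fun_prop
    simpa [γx, γv] using hc.tendsto 0
  have h1 := (hline u₀ (v 0)).hasFDerivAt.congr_of_eventuallyEq (hcurve.eventually hF.input_eq)
  have := DFunLike.congr_fun (h1.unique hcomp) (1 : ℝ)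
  simpa using this

/-- The shifts of a flat output up to the orders `R` are locally free: they attain all values near
the equilibrium along trajectories near the equilibrium. -/
theorem IsParametrization.eventually_jet (hf : IsDiscreteSystem f x₀ u₀)
    (hφ : SmoothNear φ (x₀, u₀)) (hF : IsParametrization f x₀ u₀ φ R Fx Fu)
    {p : ((j : Fin m) → Fin (R j + 1) → ℝ) → Prop}
    (hp : ∀ᶠ q : (Fin n → ℝ) × (ℕ → Fin m → ℝ) in 𝓝 (x₀, fun _ => u₀),
      p (outputJet f φ (fun j => R j + 1) q.1 q.2)) :
    ∀ᶠ q in 𝓝 (fun j _ => φ (x₀, u₀) j), p q := by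
  set r := Finset.univ.sup R
  have hr : ∀ j, R j ≤ r := fun j => Finset.le_sup (Finset.mem_univ j)
  -- The jet involves only the inputs at times `0, …, r`. Freezing the others at `u₀` gives a
  -- finite-dimensional normed domain on which to differentiate.
  let E := (Fin n → ℝ) × (Fin (r + 1) → Fin m → ℝ)
  let v : ℕ → E → Fin m → ℝ := fun i q => if h : i < r + 1 then q.2 ⟨i, h⟩ else u₀
  let v' : ℕ → E →L[ℝ] Fin m → ℝ := fun i => if h : i < r + 1 then
    (ContinuousLinearMap.proj (R := ℝ) (φ := fun _ : Fin (r + 1) => Fin m → ℝ) ⟨i, h⟩).comp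
      (ContinuousLinearMap.snd ℝ (Fin n → ℝ) (Fin (r + 1) → Fin m → ℝ)) else 0
  let q₀ : E := (x₀, fun _ => u₀)
  have hv : ∀ i, HasStrictFDerivAt (v i) (v' i) q₀ := by
    intro i
    by_cases h : i < r + 1
    · simp only [v, v', h, dite_true]
      exact ContinuousLinearMap.hasStrictFDerivAt (E := E)
        ((ContinuousLinearMap.proj (R := ℝ) (φ := fun _ : Fin (r + 1) => Fin m → ℝ) ⟨i, h⟩).comp
          (ContinuousLinearMap.snd ℝ (Fin n → ℝ) (Fin (r + 1) → Fin m → ℝ)))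
    · simp only [v, v', h, dite_false]
      exact hasStrictFDerivAt_const _ _
  have hv₀ : ∀ i, v i q₀ = u₀ := by
    intro i
    by_cases h : i < r + 1 <;> simp [v, q₀]
  choose L hL hL' using exists_hasStrictFDerivAt_forwardShift hf.smooth.hasStrictFDerivAt
    hφ.hasStrictFDerivAt hf.equilibrium (hasStrictFDerivAt_fst (p := q₀)) hv rfl hv₀
  let J : E → (j : Fin m) → Fin (R j + 1) → ℝ := fun q =>
    outputJet f φ (fun j => R j + 1) q.1 (fun i => v i q)
  let J' : E →L[ℝ] (j : Fin m) → Fin (R j + 1) → ℝ :=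
    ContinuousLinearMap.pi fun j => ContinuousLinearMap.pi fun k =>
      (ContinuousLinearMap.proj (R := ℝ) (φ := fun _ : Fin m => ℝ) j).comp (L k)
  have hJ : HasStrictFDerivAt J J' q₀ := by
    rw [hasStrictFDerivAt_pi']
    intro j
    rw [hasStrictFDerivAt_pi']
    intro k
    exact hasStrictFDerivAt_pi'.1 (hL k) j
  have hsurj : J'.range = ⊤ := by
    rw [LinearMap.range_eq_top]
    intro t
    obtain ⟨x, w, hw⟩ := forwardShift_surjective_of_reconstructible rfl
      (fderiv ℝ f (x₀, u₀)).toLinearMap (fderiv ℝ φ (x₀, u₀)).toLinearMap r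
      (fun x w h => hF.linearized_input_eq hf hφ x w fun j k hk =>
        congrFun (h k (hk.trans (hr j))) j)
      (r + 1) (fun k j => if h : (k : ℕ) < R j + 1 then t j ⟨k, h⟩ else 0)
    refine ⟨(x, fun i => w i), ?_⟩
    funext j k
    have hk : (k : ℕ) < r + 1 := k.2.trans_le (Nat.succ_le_succ (hr j))
    have h1 := congrFun (hw ⟨k, hk⟩) j
    have h2 := congrFun (hL' k (x, fun i => w i)) j
    simp only [Fin.is_lt, dite_true, Fin.eta] at h1
    refine Eq.trans h2 (Eq.trans (congrFun ?_ j) h1)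
    refine forwardShift_congr _ _ _ fun i hi => ?_
    have hi' : i < r + 1 := hi.trans_lt hk
    simp [v', Nat.lt_succ_iff.1 hi']
  have hJ₀ : J q₀ = fun j _ => φ (x₀, u₀) j := by
    simp only [J, hv₀]
    exact outputJet_equilibrium hf.equilibrium _
  have hcurve : Filter.Tendsto (fun q : E => (q.1, fun i => v i q)) (𝓝 q₀)
      (𝓝 (x₀, fun _ => u₀)) := by
    refine Filter.Tendsto.prodMk_nhds continuousAt_fst (tendsto_pi_nhds.2 fun i => ?_)
    simpa only [ContinuousAt, hv₀] using (hv i).continuousAt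
  -- A surjective strict derivative makes the jet map open at the equilibrium, so the jets of nearby
  -- trajectories fill a neighbourhood.
  have hmap := hJ.map_nhds_eq_of_surj hsurj
  rw [hJ₀] at hmap
  rw [← hmap]
  exact hcurve.eventually hp

/-- The shifts of orders `0, …, R j - 1` among those of orders `0, …, R j`. -/
def jetInit (q : (j : Fin m) → Fin (R j + 1) → ℝ) : (j : Fin m) → Fin (R j) → ℝ :=
  fun j k => q j k.castSucc

/-- The shifts of orders `1, …, R j` among those of orders `0, …, R j`. -/
def jetTail (q : (j : Fin m) → Fin (R j + 1) → ℝ) : (j : Fin m) → Fin (R j) → ℝ :=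
  fun j k => q j k.succ

theorem continuous_jetInit : Continuous (jetInit (R := R)) := by
  unfold jetInit; fun_prop

theorem continuous_jetTail : Continuous (jetTail (R := R)) := by
  unfold jetTail; fun_prop

theorem tendsto_shift (hf : IsDiscreteSystem f x₀ u₀) :
    Filter.Tendsto (fun p : (Fin n → ℝ) × (ℕ → Fin m → ℝ) => (f (p.1, p.2 0), fun i => p.2 (i + 1)))
      (𝓝 (x₀, fun _ => u₀)) (𝓝 (x₀, fun _ => u₀)) := by
  refine Filter.Tendsto.prodMk_nhds ?_ ?_
  · have h1 : Filter.Tendsto (fun p : (Fin n → ℝ) × (ℕ → Fin m → ℝ) => (p.1, p.2 0))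
        (𝓝 (x₀, fun _ => u₀)) (𝓝 (x₀, u₀)) :=
      Continuous.tendsto' (by fun_prop) _ _ rfl
    have h2 := hf.smooth.continuousAt.tendsto.comp h1
    rwa [hf.equilibrium] at h2
  · exact Continuous.tendsto' (by fun_prop) _ _ rfl

theorem outputJet_shift (N : Fin m → ℕ) (x : Fin n → ℝ) (v : ℕ → Fin m → ℝ) :
    jetTail (outputJet f φ (fun j => N j + 1) x v)
      = outputJet f φ N (f (x, v 0)) (fun i => v (i + 1)) := by
  funext j k
  exact forwardShift_succ f (fun p => φ p j) x v k

/-- Along a trajectory, the tail of the jet is the jet at the successor state, so `Fx` returns that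
state. Freeness then removes the trajectory. -/
theorem IsParametrization.state_shift (hf : IsDiscreteSystem f x₀ u₀)
    (hφ : SmoothNear φ (x₀, u₀)) (hF : IsParametrization f x₀ u₀ φ R Fx Fu) :
    ∀ᶠ q in 𝓝 (fun j _ => φ (x₀, u₀) j), Fx (jetTail q) = f (Fx (jetInit q), Fu q) := by
  refine hF.eventually_jet hf hφ ?_
  filter_upwards [hF.state_eq, hF.input_eq, (tendsto_shift hf).eventually hF.state_eq]
    with p h1 h2 h3
  rw [outputJet_shift, h3, h2]
  exact congrArg (fun x => f (x, p.2 0)) h1.symm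

theorem IsParametrization.output_eq (hf : IsDiscreteSystem f x₀ u₀)
    (hφ : SmoothNear φ (x₀, u₀)) (hF : IsParametrization f x₀ u₀ φ R Fx Fu) :
    ∀ᶠ q in 𝓝 (fun j _ => φ (x₀, u₀) j), ∀ j, φ (Fx (jetInit q), Fu q) j = q j 0 := by
  refine hF.eventually_jet hf hφ ?_
  filter_upwards [hF.state_eq, hF.input_eq] with p h1 h2 j
  rw [h2]
  exact congrArg (fun x => φ (x, p.2 0) j) h1

theorem IsParametrization.state_equilibrium (hf : IsDiscreteSystem f x₀ u₀)
    (hF : IsParametrization f x₀ u₀ φ R Fx Fu) : Fx (fun j _ => φ (x₀, u₀) j) = x₀ := by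
  have := hF.state_eq.self_of_nhds
  rwa [outputJet_equilibrium hf.equilibrium] at this

theorem IsParametrization.input_equilibrium (hf : IsDiscreteSystem f x₀ u₀)
    (hF : IsParametrization f x₀ u₀ φ R Fx Fu) : Fu (fun j _ => φ (x₀, u₀) j) = u₀ := by
  have := hF.input_eq.self_of_nhds
  rwa [outputJet_equilibrium hf.equilibrium] at this

/-- The line through the equilibrium jet along which only the highest shift of `y j` varies. -/
def topLine (q₀ : (j : Fin m) → Fin (R j + 1) → ℝ) (j : Fin m) (t : ℝ) :
    (j : Fin m) → Fin (R j + 1) → ℝ :=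
  q₀ + t • (Pi.single j (Pi.single (Fin.last (R j)) 1) : (j : Fin m) → Fin (R j + 1) → ℝ)

theorem hasDerivAt_topLine (q₀ : (j : Fin m) → Fin (R j + 1) → ℝ) (j : Fin m) (t : ℝ) :
    HasDerivAt (topLine q₀ j) (Pi.single j (Pi.single (Fin.last (R j)) 1)) t := by
  have h := ((hasDerivAt_id t).smul_const
    (Pi.single j (Pi.single (Fin.last (R j)) 1) : (j : Fin m) → Fin (R j + 1) → ℝ)).const_add q₀
  rw [one_smul] at h
  exact h

theorem topLine_zero (q₀ : (j : Fin m) → Fin (R j + 1) → ℝ) (j : Fin m) :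
    topLine q₀ j 0 = q₀ := by simp [topLine]

theorem topLine_last (q₀ : (j : Fin m) → Fin (R j + 1) → ℝ) (j : Fin m) (t : ℝ) :
    topLine q₀ j t j (Fin.last (R j)) = q₀ j (Fin.last (R j)) + t := by simp [topLine]

theorem topLine_of_ne (q₀ : (j : Fin m) → Fin (R j + 1) → ℝ) {j i : Fin m} (t : ℝ)
    {k : Fin (R i + 1)} (h : i = j → (k : ℕ) ≠ R j) : topLine q₀ j t i k = q₀ i k := by
  by_cases hij : i = j
  · subst hij
    have hk : k ≠ Fin.last (R i) := fun hk => h rfl (by simp [hk])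
    simp [topLine, hk]
  · simp [topLine, hij]

theorem jetInit_topLine (q₀ : (j : Fin m) → Fin (R j + 1) → ℝ) (j : Fin m) (t : ℝ) :
    jetInit (topLine q₀ j t) = jetInit q₀ := by
  funext i k
  refine topLine_of_ne q₀ t fun h => ?_
  subst h
  exact k.2.ne

theorem tendsto_topLine (q₀ : (j : Fin m) → Fin (R j + 1) → ℝ) (j : Fin m) :
    Filter.Tendsto (topLine q₀ j) (𝓝 0) (𝓝 q₀) := by
  have := (hasDerivAt_topLine q₀ j 0).continuousAt
  rwa [ContinuousAt, topLine_zero] at this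

theorem IsParametrization.hasDerivAt_topLine (hF : IsParametrization f x₀ u₀ φ R Fx Fu)
    (j : Fin m) : HasDerivAt (fun t => Fu (topLine (fun j _ => φ (x₀, u₀) j) j t))
      (fderiv ℝ Fu (fun j _ => φ (x₀, u₀) j) (Pi.single j (Pi.single (Fin.last (R j)) 1))) 0 := by
  refine HasFDerivAt.comp_hasDerivAt (l := Fu) 0 ?_ (_root_.hasDerivAt_topLine _ j 0)
  rw [topLine_zero]
  exact hF.smooth_u.hasStrictFDerivAt.hasFDerivAt

/-- Every component of a flat output enters the parametrization of the state. -/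
theorem IsParametrization.order_pos (hf : IsDiscreteSystem f x₀ u₀)
    (hφ : SmoothNear φ (x₀, u₀)) (hF : IsParametrization f x₀ u₀ φ R Fx Fu) (j : Fin m) :
    0 < R j := by
  by_contra hj
  have hj : R j = 0 := by omega
  set q₀ : (j : Fin m) → Fin (R j + 1) → ℝ := fun j _ => φ (x₀, u₀) j
  have hinit : Fx (jetInit q₀) = x₀ := hF.state_equilibrium hf
  -- If `R j = 0`, then `y j` occurs neither in the initial nor in the tail jet. Moving it alone
  -- fixes the state and its successor, so injectivity of `∂f/∂u` gives the input velocity zero,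
  -- whereas `φ j` would have to follow `y j` with velocity one.
  have htail : ∀ t, jetTail (topLine q₀ j t) = jetTail q₀ := fun t => by
    funext i k
    refine topLine_of_ne q₀ t fun h => ?_
    subst h
    exact absurd k.2 (by omega)
  have hFu := hF.hasDerivAt_topLine j
  set e := fderiv ℝ Fu q₀ (Pi.single j (Pi.single (Fin.last (R j)) 1))
  have hFu₀ : Fu (topLine q₀ j 0) = u₀ := by rw [topLine_zero]; exact hF.input_equilibrium hf
  have he : e = 0 := by
    have h1 : HasFDerivAt (fun u => f (x₀, u)) (fderiv ℝ (fun u => f (x₀, u)) u₀)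
        (Fu (topLine q₀ j 0)) := by
      rw [hFu₀]
      refine DifferentiableAt.hasFDerivAt ?_
      exact DifferentiableAt.comp (g := f) u₀ (hf.smooth.contDiffAt.differentiableAt (by simp))
        ((differentiableAt_const _).prodMk differentiableAt_id)
    have h2 := h1.comp_hasDerivAt (0 : ℝ) hFu
    have h3 : HasDerivAt (fun t => f (x₀, Fu (topLine q₀ j t))) 0 0 := by
      refine (hasDerivAt_const (0 : ℝ) x₀).congr_of_eventuallyEq ?_
      filter_upwards [(tendsto_topLine q₀ j).eventually (hF.state_shift hf hφ)] with t ht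
      rw [htail, jetInit_topLine, hinit] at ht
      rw [← ht]
      exact hF.state_equilibrium hf
    exact hf.independent_inputs ((h2.unique h3).trans (map_zero _).symm)
  have h1 : HasFDerivAt (fun u => φ (x₀, u) j) (fderiv ℝ (fun u => φ (x₀, u) j) u₀)
      (Fu (topLine q₀ j 0)) := by
    rw [hFu₀]
    refine DifferentiableAt.hasFDerivAt ?_
    refine differentiableAt_pi.1 ?_ j
    exact DifferentiableAt.comp (g := φ) u₀ (hφ.contDiffAt.differentiableAt (by simp))
      ((differentiableAt_const _).prodMk differentiableAt_id)
  have h2 := h1.comp_hasDerivAt (0 : ℝ) hFu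
  have h3 : HasDerivAt (fun t => φ (x₀, Fu (topLine q₀ j t)) j) 1 0 := by
    refine ((hasDerivAt_id (0 : ℝ)).const_add (q₀ j 0)).congr_of_eventuallyEq ?_
    filter_upwards [(tendsto_topLine q₀ j).eventually (hF.output_eq hf hφ)] with t ht
    have := ht j
    rw [jetInit_topLine, hinit] at this
    rw [this]
    have h0 : (0 : Fin (R j + 1)) = Fin.last (R j) := Fin.ext (by simp [hj])
    rw [h0, topLine_last]
    rfl
  have := h2.unique h3
  rw [he, map_zero] at this
  exact zero_ne_one this

/-- The relative degree of a component of a flat output does not exceed its order in the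
parametrization. -/
theorem IsParametrization.relativeDegree_le (hf : IsDiscreteSystem f x₀ u₀)
    (hφ : SmoothNear φ (x₀, u₀)) (hF : IsParametrization f x₀ u₀ φ R Fx Fu) {j : Fin m} {ρ : ℕ}
    (hρ : HasRelativeDegree f x₀ u₀ (fun p => φ p j) ρ) : ρ ≤ R j := by
  by_contra! hlt
  set q₀ : (j : Fin m) → Fin (R j + 1) → ℝ := fun j _ => φ (x₀, u₀) j
  -- If `R j < ρ`, the shift of order `R j` depends on the state alone, hence on the lower jet,
  -- against freeness.
  have h1 : ∀ᶠ q in 𝓝 q₀, q j (Fin.last (R j))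
      = forwardShift f (fun p => φ p j) (R j) (Fx (jetInit q)) (fun _ => u₀) := by
    refine hF.eventually_jet hf hφ ?_
    filter_upwards [hF.state_eq, hρ.1 (R j) hlt] with p h1 h2
    exact h2.trans (congrArg (fun x => forwardShift f (fun p => φ p j) (R j) x _) h1.symm)
  have h2 : ∀ᶠ t in 𝓝 (0 : ℝ), t = 0 := by
    filter_upwards [(tendsto_topLine q₀ j).eventually h1] with t ht
    have h3 := h1.self_of_nhds
    rw [jetInit_topLine, topLine_last] at ht
    linarith
  have h4 : ∀ᶠ t in 𝓝[>] (0 : ℝ), t = 0 := h2.filter_mono nhdsWithin_le_nhds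
  obtain ⟨t, ht, ht'⟩ := (h4.and self_mem_nhdsWithin).exists
  exact ht'.ne' ht

/-- Beyond the relative degree, the shifts are those of the function `h_[ρ] (x, u)`. -/
theorem HasRelativeDegree.forwardShift_eq (hf : IsDiscreteSystem f x₀ u₀)
    {h : (Fin n → ℝ) × (Fin m → ℝ) → ℝ} {ρ : ℕ} (hρ : HasRelativeDegree f x₀ u₀ h ρ) (l : ℕ) :
    ∀ᶠ p : (Fin n → ℝ) × (ℕ → Fin m → ℝ) in 𝓝 (x₀, fun _ => u₀),
      forwardShift f h (ρ + l) p.1 p.2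
        = shiftOfInput f u₀ h ρ (stateAt f p.1 p.2 l, p.2 l) := by
  induction l with
  | zero =>
    cases ρ with
    | zero => exact Filter.Eventually.of_forall fun p => rfl
    | succ ρ =>
      -- After one step the remaining `ρ` shifts no longer see any input, so only the first input
      -- survives.
      filter_upwards [(tendsto_shift hf).eventually (hρ.1 ρ ρ.lt_succ_self)] with p hp
      rw [add_zero, forwardShift_succ, hp, shiftOfInput, forwardShift_succ]
      rfl
  | succ l ih =>
    filter_upwards [(tendsto_shift hf).eventually ih] with p hp
    rw [← add_assoc, forwardShift_succ, hp]
    rw [add_comm l 1, stateAt_add]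
    simp only [stateAt, add_comm]

theorem IsParametrization.shiftOfInput_eq (hf : IsDiscreteSystem f x₀ u₀)
    (hφ : SmoothNear φ (x₀, u₀)) (hF : IsParametrization f x₀ u₀ φ R Fx Fu) {j : Fin m} {ρ : ℕ}
    (hρ : HasRelativeDegree f x₀ u₀ (fun p => φ p j) ρ) (hlt : ρ < R j + 1) :
    ∀ᶠ q in 𝓝 (fun j _ => φ (x₀, u₀) j),
      shiftOfInput f u₀ (fun p => φ p j) ρ (Fx (jetInit q), Fu q) = q j ⟨ρ, hlt⟩ := by
  refine hF.eventually_jet hf hφ ?_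
  filter_upwards [hF.state_eq, hF.input_eq, hρ.forwardShift_eq hf 0] with p h1 h2 h3
  rw [h2]
  exact (congrArg (fun x => shiftOfInput f u₀ _ ρ (x, p.2 0)) h1).trans h3.symm

theorem smoothNear_shiftOfInput (hf : IsDiscreteSystem f x₀ u₀)
    {h : (Fin n → ℝ) × (Fin m → ℝ) → ℝ} (hh : SmoothNear h (x₀, u₀)) (k : ℕ) :
    SmoothNear (shiftOfInput f u₀ h k) (x₀, u₀) := by
  refine smoothNear_forwardShift (p := (x₀, u₀)) (x := fun p => p.1)
    (v := fun i p => if i = 0 then p.2 else u₀) hf.smooth hh hf.equilibrium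
    (contDiff_fst.smoothNear _) (fun i => ?_) rfl (fun i => by simp) k
  by_cases hi : i = 0
  · simp only [hi, if_true]; exact contDiff_snd.smoothNear _
  · simp only [hi, if_false]; exact contDiff_const.smoothNear _

theorem shiftOfInput_equilibrium (hf : IsDiscreteSystem f x₀ u₀)
    (h : (Fin n → ℝ) × (Fin m → ℝ) → ℝ) (k : ℕ) :
    shiftOfInput f u₀ h k (x₀, u₀) = h (x₀, u₀) := by
  simp only [shiftOfInput, ite_self]
  exact forwardShift_equilibrium hf.equilibrium h k

end Parametrization

/-! ### Introducing `φ¹_[ρ]` as a new input -/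

section InputTransformation

variable {n : ℕ} {f : (Fin n → ℝ) × (Fin 2 → ℝ) → (Fin n → ℝ)}
  {x₀ : Fin n → ℝ} {u₀ : Fin 2 → ℝ} {φ : (Fin n → ℝ) × (Fin 2 → ℝ) → (Fin 2 → ℝ)} {ρ : ℕ}

theorem smoothNear_apply {m : ℕ} {φ : (Fin n → ℝ) × (Fin m → ℝ) → (Fin m → ℝ)}
    {u₀ : Fin m → ℝ} (hφ : SmoothNear φ (x₀, u₀)) (j : Fin m) :
    SmoothNear (fun p => φ p j) (x₀, u₀) := by
  filter_upwards [hφ] with p hp using contDiffAt_pi.1 hp j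

theorem smoothNear_outputInputMap (hf : IsDiscreteSystem f x₀ u₀) (hφ : SmoothNear φ (x₀, u₀))
    (ρ : ℕ) (i : Fin 2) : SmoothNear (outputInputMap f u₀ φ ρ i) (x₀, u₀) := by
  refine SmoothNear.pi (Fin.forall_fin_two.2 ⟨?_, ?_⟩)
  · exact smoothNear_shiftOfInput hf (smoothNear_apply hφ 0) ρ
  · have h : ContDiff ℝ ∞ fun p : (Fin n → ℝ) × (Fin 2 → ℝ) => p.2 i := by fun_prop
    exact h.smoothNear _

theorem outputInputMap_equilibrium (hf : IsDiscreteSystem f x₀ u₀) (ρ : ℕ) (i : Fin 2) :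
    outputInputMap f u₀ φ ρ i (x₀, u₀) = ![φ (x₀, u₀) 0, u₀ i] := by
  rw [outputInputMap, shiftOfInput_equilibrium hf]

/-- After a suitable numbering of the inputs, a function of relative degree `ρ` can be introduced
as a new input. -/
theorem HasRelativeDegree.exists_isInputTransformation (hf : IsDiscreteSystem f x₀ u₀)
    (hφ : SmoothNear φ (x₀, u₀)) (hρ : HasRelativeDegree f x₀ u₀ (fun p => φ p 0) ρ) :
    ∃ i Φ, IsInputTransformation x₀ u₀ (outputInputMap f u₀ φ ρ i) Φ := by
  set ψ := shiftOfInput f u₀ (fun q => φ q 0) ρ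
  have hψ : SmoothNear ψ (x₀, u₀) := smoothNear_shiftOfInput hf (smoothNear_apply hφ 0) ρ
  have hpart : ∀ b, fderiv ℝ (fun u => ψ (x₀, u)) u₀ b = fderiv ℝ ψ (x₀, u₀) (0, b) := by
    have h1 := hψ.hasStrictFDerivAt.hasFDerivAt.comp u₀
      ((hasFDerivAt_const x₀ u₀).prodMk (hasFDerivAt_id u₀))
    intro b
    have h2 : fderiv ℝ (fun u => ψ (x₀, u)) u₀ = _ := h1.fderiv
    rw [h2]
    rfl
  -- If both numberings failed, the input derivative of `ψ` would vanish on both coordinate axes and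
  -- therefore be zero.
  obtain ⟨i, hi⟩ : ∃ i : Fin 2, ∀ b : Fin 2 → ℝ, b i = 0 →
      fderiv ℝ ψ (x₀, u₀) (0, b) = 0 → b = 0 := by
    by_contra! hcon
    refine hρ.2 ?_
    obtain ⟨b, hb, hb', hb0⟩ := hcon 0
    obtain ⟨c, hc, hc', hc0⟩ := hcon 1
    rw [← hpart] at hb' hc'
    have hb1 : b 1 ≠ 0 := fun h => hb0 (funext (Fin.forall_fin_two.2 ⟨hb, h⟩))
    have hc1 : c 0 ≠ 0 := fun h => hc0 (funext (Fin.forall_fin_two.2 ⟨h, hc⟩))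
    ext a
    have ha : a = (a 0 / c 0) • c + (a 1 / b 1) • b := by
      refine funext (Fin.forall_fin_two.2 ⟨?_, ?_⟩)
      · simp [hb, hc1]
      · simp [hc, hb1]
    rw [ha, map_add, map_smul, map_smul, hb', hc']
    simp
  set Ψ := outputInputMap f u₀ φ ρ i
  have hΨ : SmoothNear Ψ (x₀, u₀) := smoothNear_outputInputMap hf hφ ρ i
  have hg : SmoothNear (fun p => (p.1, Ψ p)) (x₀, u₀) := (contDiff_fst.smoothNear _).prodMk hΨ
  have hg' : ∀ δ, fderiv ℝ (fun p => (p.1, Ψ p)) (x₀, u₀) δ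
      = (δ.1, ![fderiv ℝ ψ (x₀, u₀) δ, δ.2 i]) := by
    intro δ
    have h1 : HasFDerivAt Ψ (ContinuousLinearMap.pi ![fderiv ℝ ψ (x₀, u₀),
        (ContinuousLinearMap.proj (R := ℝ) (φ := fun _ : Fin 2 => ℝ) i).comp
          (ContinuousLinearMap.snd ℝ (Fin n → ℝ) (Fin 2 → ℝ))]) (x₀, u₀) := by
      refine hasFDerivAt_pi.2 (Fin.forall_fin_two.2 ⟨?_, ?_⟩)
      · exact hψ.hasStrictFDerivAt.hasFDerivAt
      · exact ((ContinuousLinearMap.proj (R := ℝ) (φ := fun _ : Fin 2 => ℝ) i).comp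
          (ContinuousLinearMap.snd ℝ (Fin n → ℝ) (Fin 2 → ℝ))).hasFDerivAt
    rw [(hasFDerivAt_fst.prodMk h1).fderiv]
    refine Prod.ext rfl (funext (Fin.forall_fin_two.2 ⟨rfl, rfl⟩))
  have hinj : Function.Injective (fderiv ℝ (fun p => (p.1, Ψ p)) (x₀, u₀)) := by
    rw [injective_iff_map_eq_zero]
    rintro ⟨a, b⟩ hab
    rw [hg'] at hab
    have ha : a = 0 := congrArg Prod.fst hab
    have hb := congrArg Prod.snd hab
    subst ha
    rw [hi b (congrFun hb 1) (congrFun hb 0)]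
    rfl
  obtain ⟨-, h, hh, h1, h2⟩ := hg.isLocalDiffeoNear
    ⟨hinj, (LinearMap.injective_iff_surjective (f := (fderiv ℝ (fun p => (p.1, Ψ p))
      (x₀, u₀)).toLinearMap)).1 hinj⟩
  refine ⟨i, fun q => (h q).2, hΨ, contDiff_snd.smoothNear _ |>.comp hh rfl, ?_, ?_⟩
  · filter_upwards [h1] with p hp
    rw [hp]
  · filter_upwards [h2] with q hq
    have h3 : (h q).1 = q.1 := (Prod.ext_iff.1 hq).1
    rw [← h3]
    exact (Prod.ext_iff.1 hq).2

end InputTransformation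

/-! ### The prolongation in jet coordinates -/

/-- The standing assumptions for the prolongation of a system along a component of a flat
output. -/
structure IsRegularProlongation {n : ℕ} (f : (Fin n → ℝ) × (Fin 2 → ℝ) → (Fin n → ℝ))
    (x₀ : Fin n → ℝ) (u₀ : Fin 2 → ℝ) (φ : (Fin n → ℝ) × (Fin 2 → ℝ) → (Fin 2 → ℝ))
    (R : Fin 2 → ℕ) (Fx : ((j : Fin 2) → Fin (R j) → ℝ) → (Fin n → ℝ))
    (Fu : ((j : Fin 2) → Fin (R j + 1) → ℝ) → (Fin 2 → ℝ)) (ρ d : ℕ) (i : Fin 2)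
    (Φ : (Fin n → ℝ) × (Fin 2 → ℝ) → (Fin 2 → ℝ)) : Prop where
  sys : IsDiscreteSystem f x₀ u₀
  out : SmoothNear φ (x₀, u₀)
  par : IsParametrization f x₀ u₀ φ R Fx Fu
  deg : HasRelativeDegree f x₀ u₀ (fun p => φ p 0) ρ
  reg : fderiv ℝ Fu (fun j _ => φ (x₀, u₀) j) (Pi.single 1 (Pi.single (Fin.last (R 1)) 1)) ≠ 0
  trans : IsInputTransformation x₀ u₀ (outputInputMap f u₀ φ ρ i) Φ
  order : ρ + d = R 0

/-- The chain `(ū¹, …, ū¹_[d])` formed by the state and the first input of the prolongation. -/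
def extendedChain {n d : ℕ} (p : ((Fin n → ℝ) × (Fin d → ℝ)) × (Fin 2 → ℝ)) : Fin (d + 1) → ℝ :=
  Fin.snoc (α := fun _ => ℝ) p.1.2 (p.2 0)

/-- The original input `u` as a function of the state and the input of the prolongation. -/
def prolongedInput {n : ℕ} (Φ : (Fin n → ℝ) × (Fin 2 → ℝ) → (Fin 2 → ℝ)) (d : ℕ)
    (p : ((Fin n → ℝ) × (Fin d → ℝ)) × (Fin 2 → ℝ)) : Fin 2 → ℝ :=
  Φ (p.1.1, ![extendedChain p 0, p.2 1])

/-- The prolongation under a constant input. -/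
def closedLoop {n : ℕ} (f : (Fin n → ℝ) × (Fin 2 → ℝ) → (Fin n → ℝ))
    (Φ : (Fin n → ℝ) × (Fin 2 → ℝ) → (Fin 2 → ℝ)) (d : ℕ) (w : Fin 2 → ℝ)
    (z : (Fin n → ℝ) × (Fin d → ℝ)) : (Fin n → ℝ) × (Fin d → ℝ) :=
  prolongation f Φ d (z, w)

/-- The shifts of the output along the prolongation under a constant input. -/
def closedLoopJet {n : ℕ} (f : (Fin n → ℝ) × (Fin 2 → ℝ) → (Fin n → ℝ))
    (φ : (Fin n → ℝ) × (Fin 2 → ℝ) → (Fin 2 → ℝ)) (R : Fin 2 → ℕ)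
    (Φ : (Fin n → ℝ) × (Fin 2 → ℝ) → (Fin 2 → ℝ)) (d : ℕ) (w : Fin 2 → ℝ)
    (z : (Fin n → ℝ) × (Fin d → ℝ)) : (j : Fin 2) → Fin (R j) → ℝ := fun j k =>
  φ (((closedLoop f Φ d w)^[k] z).1, prolongedInput Φ d ((closedLoop f Φ d w)^[k] z, w)) j

/-- The state of the prolongation as a function of the shifts of the flat output. -/
def prolongedState {n : ℕ} {R : Fin 2 → ℕ} (Fx : ((j : Fin 2) → Fin (R j) → ℝ) → (Fin n → ℝ))
    {ρ d : ℕ} (h : ρ + d = R 0) (y : (j : Fin 2) → Fin (R j) → ℝ) :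
    (Fin n → ℝ) × (Fin d → ℝ) :=
  (Fx y, fun l => y 0 ⟨ρ + l, by omega⟩)

/-- The input of the prolongation as a function of the shifts of the flat output. -/
def prolongedControl {R : Fin 2 → ℕ} (Fu : ((j : Fin 2) → Fin (R j + 1) → ℝ) → (Fin 2 → ℝ))
    (i : Fin 2) (q : (j : Fin 2) → Fin (R j + 1) → ℝ) : Fin 2 → ℝ :=
  ![q 0 (Fin.last (R 0)), Fu q i]

/-- The jets of orders `0, …, R j` from those of orders `0, …, R j - 1` and the highest shifts. -/
def jetSnoc {m : ℕ} {R : Fin m → ℕ} (p : ((j : Fin m) → Fin (R j) → ℝ) × (Fin m → ℝ)) :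
    (j : Fin m) → Fin (R j + 1) → ℝ :=
  fun j => Fin.snoc (α := fun _ => ℝ) (p.1 j) (p.2 j)

section Prolongation

variable {n : ℕ} {f : (Fin n → ℝ) × (Fin 2 → ℝ) → (Fin n → ℝ)}
  {x₀ : Fin n → ℝ} {u₀ : Fin 2 → ℝ} {φ : (Fin n → ℝ) × (Fin 2 → ℝ) → (Fin 2 → ℝ)}
  {R : Fin 2 → ℕ} {Fx : ((j : Fin 2) → Fin (R j) → ℝ) → (Fin n → ℝ)}
  {Fu : ((j : Fin 2) → Fin (R j + 1) → ℝ) → (Fin 2 → ℝ)} {ρ d : ℕ} {i : Fin 2}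
  {Φ : (Fin n → ℝ) × (Fin 2 → ℝ) → (Fin 2 → ℝ)}

theorem prolongation_eq (p : ((Fin n → ℝ) × (Fin d → ℝ)) × (Fin 2 → ℝ)) :
    prolongation f Φ d p = (f (p.1.1, prolongedInput Φ d p), fun k => extendedChain p k.succ) :=
  rfl

theorem extendedChain_apply (p : ((Fin n → ℝ) × (Fin d → ℝ)) × (Fin 2 → ℝ)) (k : Fin (d + 1)) :
    extendedChain p k = if h : (k : ℕ) < d then p.1.2 ⟨k, h⟩ else p.2 0 := rfl

theorem contDiff_extendedChain : ContDiff ℝ ∞ (extendedChain (n := n) (d := d)) := by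
  refine contDiff_pi.2 fun k => ?_
  by_cases hk : (k : ℕ) < d
  · simp only [extendedChain_apply, hk, dite_true]; fun_prop
  · simp only [extendedChain_apply, hk, dite_false]; fun_prop

theorem extendedChain_const (x : Fin n → ℝ) (w : Fin 2 → ℝ) (k : Fin (d + 1)) :
    extendedChain ((x, fun _ => w 0), w) k = w 0 := by
  rw [extendedChain_apply]; split_ifs <;> rfl

/-- The chain is a shift register fed with the constant `w 0`, which fills all places beyond the
initial entries. -/
theorem extendedChain_iterate (w : Fin 2 → ℝ) (z : (Fin n → ℝ) × (Fin d → ℝ)) (l : ℕ)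
    (k : Fin (d + 1)) : extendedChain ((closedLoop f Φ d w)^[l] z, w) k
      = if h : l + k < d then z.2 ⟨l + k, h⟩ else w 0 := by
  induction l generalizing k with
  | zero => simp only [zero_add]; rfl
  | succ l ih =>
    rw [extendedChain_apply]
    by_cases hk : (k : ℕ) < d
    · rw [dif_pos hk, Function.iterate_succ_apply']
      refine (ih (Fin.succ ⟨k, hk⟩)).trans ?_
      simp only [Fin.val_succ, add_right_comm l 1, add_assoc]
    · rw [dif_neg hk, dif_neg (by omega)]

theorem stateAt_closedLoop (w : Fin 2 → ℝ) (z : (Fin n → ℝ) × (Fin d → ℝ)) (k : ℕ) :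
    stateAt f z.1 (fun k => prolongedInput Φ d ((closedLoop f Φ d w)^[k] z, w)) k
      = ((closedLoop f Φ d w)^[k] z).1 := by
  induction k with
  | zero => rfl
  | succ k ih => rw [stateAt, ih, Function.iterate_succ_apply']; rfl

/-- Unrolling the closed loop into an input sequence for `f` makes the statements about trajectories
of the original system applicable. -/
theorem closedLoopJet_eq (w : Fin 2 → ℝ) (z : (Fin n → ℝ) × (Fin d → ℝ)) :
    closedLoopJet f φ R Φ d w z = outputJet f φ R z.1
      (fun k => prolongedInput Φ d ((closedLoop f Φ d w)^[k] z, w)) := by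
  funext j k
  simp only [outputJet, forwardShift, stateAt_closedLoop]
  rfl

theorem jetInit_jetSnoc (p : ((j : Fin 2) → Fin (R j) → ℝ) × (Fin 2 → ℝ)) :
    jetInit (jetSnoc p) = p.1 := by
  funext j k
  simp [jetInit, jetSnoc]

theorem jetSnoc_last (p : ((j : Fin 2) → Fin (R j) → ℝ) × (Fin 2 → ℝ)) (j : Fin 2) :
    jetSnoc p j (Fin.last (R j)) = p.2 j := by
  simp [jetSnoc]

theorem contDiff_jetSnoc : ContDiff ℝ ∞ (jetSnoc (R := R)) := by
  refine contDiff_pi.2 fun j => contDiff_pi.2 fun k => ?_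
  refine Fin.lastCases ?_ (fun k => ?_) k
  · simp only [jetSnoc, Fin.snoc_last]; fun_prop
  · simp only [jetSnoc, Fin.snoc_castSucc]
    exact contDiff_pi.1 (contDiff_pi.1 contDiff_fst j) k

namespace IsRegularProlongation

theorem input_equilibrium (H : IsRegularProlongation f x₀ u₀ φ R Fx Fu ρ d i Φ) :
    Φ (x₀, outputInputMap f u₀ φ ρ i (x₀, u₀)) = u₀ :=
  H.trans.left_inv.self_of_nhds

theorem chain_equilibrium (w : Fin 2 → ℝ) :
    ((x₀, ![extendedChain ((x₀, fun _ : Fin d => w 0), w) 0, w 1]) :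
      (Fin n → ℝ) × (Fin 2 → ℝ)) = (x₀, w) := by
  rw [extendedChain_const]
  exact Prod.ext rfl (funext (Fin.forall_fin_two.2 ⟨rfl, rfl⟩))

theorem prolongedInput_equilibrium (H : IsRegularProlongation f x₀ u₀ φ R Fx Fu ρ d i Φ) :
    prolongedInput Φ d ((x₀, fun _ => outputInputMap f u₀ φ ρ i (x₀, u₀) 0),
      outputInputMap f u₀ φ ρ i (x₀, u₀)) = u₀ := by
  rw [prolongedInput, chain_equilibrium, H.input_equilibrium]

theorem prolongation_equilibrium (H : IsRegularProlongation f x₀ u₀ φ R Fx Fu ρ d i Φ) :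
    prolongation f Φ d ((x₀, fun _ => outputInputMap f u₀ φ ρ i (x₀, u₀) 0),
      outputInputMap f u₀ φ ρ i (x₀, u₀))
      = (x₀, fun _ => outputInputMap f u₀ φ ρ i (x₀, u₀) 0) := by
  rw [prolongation_eq, H.prolongedInput_equilibrium]
  exact Prod.ext H.sys.equilibrium (funext fun k => extendedChain_const _ _ _)

theorem smoothNear_prolongedInput (H : IsRegularProlongation f x₀ u₀ φ R Fx Fu ρ d i Φ) :
    SmoothNear (prolongedInput Φ d) ((x₀, fun _ => outputInputMap f u₀ φ ρ i (x₀, u₀) 0),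
      outputInputMap f u₀ φ ρ i (x₀, u₀)) := by
  refine H.trans.smooth_inv.comp (ContDiff.smoothNear ?_ _) (chain_equilibrium _)
  refine contDiff_fst.fst.prodMk (contDiff_pi.2 (Fin.forall_fin_two.2 ⟨?_, ?_⟩))
  · exact contDiff_pi.1 contDiff_extendedChain 0
  · simp only [Matrix.cons_val_one, Matrix.cons_val_zero]; fun_prop

theorem smoothNear_prolongation (H : IsRegularProlongation f x₀ u₀ φ R Fx Fu ρ d i Φ) :
    SmoothNear (prolongation f Φ d) ((x₀, fun _ => outputInputMap f u₀ φ ρ i (x₀, u₀) 0),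
      outputInputMap f u₀ φ ρ i (x₀, u₀)) := by
  refine SmoothNear.prodMk (g := fun p => f (p.1.1, prolongedInput Φ d p))
    (h := fun p (k : Fin d) => extendedChain p k.succ) ?_ ?_
  · have h : ContDiff ℝ ∞ fun p : ((Fin n → ℝ) × (Fin d → ℝ)) × (Fin 2 → ℝ) => p.1.1 :=
      contDiff_fst.fst
    refine SmoothNear.comp (g := f) (h := fun p => (p.1.1, prolongedInput Φ d p)) H.sys.smooth
      ((h.smoothNear _).prodMk H.smoothNear_prolongedInput) ?_
    exact Prod.ext rfl H.prolongedInput_equilibrium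
  · have h : ContDiff ℝ ∞ fun (p : ((Fin n → ℝ) × (Fin d → ℝ)) × (Fin 2 → ℝ)) (k : Fin d) =>
        extendedChain p k.succ :=
      contDiff_pi.2 fun k => contDiff_pi.1 contDiff_extendedChain k.succ
    exact h.smoothNear _

theorem iterate_equilibrium (H : IsRegularProlongation f x₀ u₀ φ R Fx Fu ρ d i Φ) (k : ℕ) :
    (closedLoop f Φ d (outputInputMap f u₀ φ ρ i (x₀, u₀)))^[k]
      (x₀, fun _ => outputInputMap f u₀ φ ρ i (x₀, u₀) 0)
      = (x₀, fun _ => outputInputMap f u₀ φ ρ i (x₀, u₀) 0) :=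
  Function.iterate_fixed H.prolongation_equilibrium k

theorem smoothNear_iterate (H : IsRegularProlongation f x₀ u₀ φ R Fx Fu ρ d i Φ) (k : ℕ) :
    SmoothNear (closedLoop f Φ d (outputInputMap f u₀ φ ρ i (x₀, u₀)))^[k]
      (x₀, fun _ => outputInputMap f u₀ φ ρ i (x₀, u₀) 0) := by
  induction k with
  | zero => exact contDiff_id.smoothNear _
  | succ k ih =>
    rw [Function.iterate_succ']
    refine H.smoothNear_prolongation.comp (ih.prodMk (contDiff_const.smoothNear _)) ?_
    rw [H.iterate_equilibrium]

theorem smoothNear_loopInput (H : IsRegularProlongation f x₀ u₀ φ R Fx Fu ρ d i Φ) (k : ℕ) :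
    SmoothNear (fun z => prolongedInput Φ d
      ((closedLoop f Φ d (outputInputMap f u₀ φ ρ i (x₀, u₀)))^[k] z,
        outputInputMap f u₀ φ ρ i (x₀, u₀)))
      (x₀, fun _ => outputInputMap f u₀ φ ρ i (x₀, u₀) 0) := by
  refine H.smoothNear_prolongedInput.comp
    ((H.smoothNear_iterate k).prodMk (contDiff_const.smoothNear _)) ?_
  rw [H.iterate_equilibrium]

theorem smoothNear_closedLoopJet (H : IsRegularProlongation f x₀ u₀ φ R Fx Fu ρ d i Φ) :
    SmoothNear (closedLoopJet f φ R Φ d (outputInputMap f u₀ φ ρ i (x₀, u₀)))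
      (x₀, fun _ => outputInputMap f u₀ φ ρ i (x₀, u₀) 0) := by
  refine SmoothNear.pi fun j => SmoothNear.pi fun k => ?_
  refine (smoothNear_apply H.out j).comp (((contDiff_fst.smoothNear _).comp
    (H.smoothNear_iterate k) rfl).prodMk (H.smoothNear_loopInput k)) ?_
  rw [H.iterate_equilibrium, H.prolongedInput_equilibrium]

theorem tendsto_loop (H : IsRegularProlongation f x₀ u₀ φ R Fx Fu ρ d i Φ) :
    Filter.Tendsto (fun z : (Fin n → ℝ) × (Fin d → ℝ) => (z.1, fun k => prolongedInput Φ d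
      ((closedLoop f Φ d (outputInputMap f u₀ φ ρ i (x₀, u₀)))^[k] z,
        outputInputMap f u₀ φ ρ i (x₀, u₀))))
      (𝓝 (x₀, fun _ => outputInputMap f u₀ φ ρ i (x₀, u₀) 0)) (𝓝 (x₀, fun _ => u₀)) := by
  refine Filter.Tendsto.prodMk_nhds continuousAt_fst (tendsto_pi_nhds.2 fun k => ?_)
  have h := (H.smoothNear_loopInput k).continuousAt
  rwa [ContinuousAt, H.iterate_equilibrium, H.prolongedInput_equilibrium] at h

/-- The shifts of the flat output along the closed loop determine the state. -/
theorem prolongedState_closedLoopJet (H : IsRegularProlongation f x₀ u₀ φ R Fx Fu ρ d i Φ) :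
    ∀ᶠ z in 𝓝 (x₀, fun _ => outputInputMap f u₀ φ ρ i (x₀, u₀) 0),
      prolongedState Fx H.order
        (closedLoopJet f φ R Φ d (outputInputMap f u₀ φ ρ i (x₀, u₀)) z) = z := by
  set w := outputInputMap f u₀ φ ρ i (x₀, u₀)
  -- The shift `y¹_[ρ+l]` is `φ¹_[ρ]` evaluated after `l` steps, hence the head of the chain at that
  -- time, hence the entry `l` of the initial chain.
  have hchain : ∀ l : Fin d, ∀ᶠ z in 𝓝 (x₀, fun _ : Fin d => w 0),
      closedLoopJet f φ R Φ d w z 0 ⟨ρ + l, by have := H.order; omega⟩ = z.2 l := by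
    intro l
    have hη : Filter.Tendsto (fun z : (Fin n → ℝ) × (Fin d → ℝ) =>
        (((closedLoop f Φ d w)^[l] z).1, ![extendedChain ((closedLoop f Φ d w)^[l] z, w) 0, w 1]))
        (𝓝 (x₀, fun _ => w 0)) (𝓝 (x₀, w)) := by
      have h1 : ContinuousAt (fun z : (Fin n → ℝ) × (Fin d → ℝ) =>
          (z.1, ![extendedChain (z, w) 0, w 1]))
          ((closedLoop f Φ d w)^[l] (x₀, fun _ => w 0)) := by
        refine continuousAt_fst.prodMk (continuousAt_pi.2 (Fin.forall_fin_two.2 ⟨?_, ?_⟩))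
        · have h2 : Continuous fun z : (Fin n → ℝ) × (Fin d → ℝ) => extendedChain (z, w) 0 :=
            ((continuous_apply (0 : Fin (d + 1))).comp contDiff_extendedChain.continuous).comp
              (by fun_prop : Continuous fun z : (Fin n → ℝ) × (Fin d → ℝ) => (z, w))
          exact h2.continuousAt
        · exact continuousAt_const
      have h3 := ContinuousAt.comp h1 (H.smoothNear_iterate l).continuousAt
      rw [ContinuousAt] at h3
      simpa only [Function.comp_def, H.iterate_equilibrium, w, chain_equilibrium] using h3
    filter_upwards [H.tendsto_loop.eventually (H.deg.forwardShift_eq H.sys l),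
      hη.eventually H.trans.right_inv] with z h1 h2
    rw [closedLoopJet_eq]
    refine h1.trans ?_
    rw [stateAt_closedLoop]
    refine (congrFun h2 0).trans ?_
    have h3 := extendedChain_iterate (f := f) (Φ := Φ) w z l 0
    simpa using h3
  filter_upwards [H.tendsto_loop.eventually H.par.state_eq, Filter.eventually_all.2 hchain]
    with z h1 h2
  refine Prod.ext ?_ (funext h2)
  rw [prolongedState, closedLoopJet_eq]
  exact h1

end IsRegularProlongation

/-- The last place `k = d` is filled by the control, which matches since `ρ + d = R 0`. -/
theorem extendedChain_prolongedState (h : ρ + d = R 0) (q : (j : Fin 2) → Fin (R j + 1) → ℝ)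
    (k : Fin (d + 1)) :
    extendedChain (prolongedState Fx h (jetInit q), prolongedControl Fu i q) k
      = q 0 ⟨ρ + k, by omega⟩ := by
  rw [extendedChain_apply]
  by_cases hk : (k : ℕ) < d
  · rw [dif_pos hk]; rfl
  · rw [dif_neg hk]
    refine congrArg (q 0) (Fin.ext ?_)
    have := k.2
    simp only [Fin.val_last]
    omega

namespace IsRegularProlongation

theorem prolongedState_equilibrium (H : IsRegularProlongation f x₀ u₀ φ R Fx Fu ρ d i Φ) :
    prolongedState Fx H.order (fun j _ => φ (x₀, u₀) j)
      = (x₀, fun _ => outputInputMap f u₀ φ ρ i (x₀, u₀) 0) := by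
  refine Prod.ext (H.par.state_equilibrium H.sys) ?_
  rw [outputInputMap_equilibrium H.sys]
  rfl

theorem prolongedControl_equilibrium (H : IsRegularProlongation f x₀ u₀ φ R Fx Fu ρ d i Φ) :
    prolongedControl Fu i (fun j _ => φ (x₀, u₀) j) = outputInputMap f u₀ φ ρ i (x₀, u₀) := by
  rw [outputInputMap_equilibrium H.sys, prolongedControl, H.par.input_equilibrium H.sys]

theorem smoothNear_prolongedState (H : IsRegularProlongation f x₀ u₀ φ R Fx Fu ρ d i Φ) :
    SmoothNear (prolongedState Fx H.order) (fun j _ => φ (x₀, u₀) j) := by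
  refine SmoothNear.prodMk H.par.smooth_x (ContDiff.smoothNear (contDiff_pi.2 fun l => ?_) _)
  exact contDiff_pi.1 (contDiff_pi.1 contDiff_id 0) _

theorem smoothNear_prolongedControl (H : IsRegularProlongation f x₀ u₀ φ R Fx Fu ρ d i Φ) :
    SmoothNear (prolongedControl Fu i) (fun j _ => φ (x₀, u₀) j) := by
  have h : ContDiff ℝ ∞ fun q : (j : Fin 2) → Fin (R j + 1) → ℝ => q 0 (Fin.last (R 0)) :=
    contDiff_pi.1 (contDiff_pi.1 contDiff_id 0) _
  refine SmoothNear.pi (Fin.forall_fin_two.2 ⟨h.smoothNear _, ?_⟩)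
  filter_upwards [H.par.smooth_u] with q hq using contDiffAt_pi.1 hq i

/-- The input of the original system along the prolongation. -/
theorem prolongedInput_eq (H : IsRegularProlongation f x₀ u₀ φ R Fx Fu ρ d i Φ) :
    ∀ᶠ q in 𝓝 (fun j _ => φ (x₀, u₀) j),
      prolongedInput Φ d (prolongedState Fx H.order (jetInit q), prolongedControl Fu i q)
        = Fu q := by
  have hlt : ρ < R 0 + 1 := by have := H.order; omega
  have hcont : Filter.Tendsto (fun q : (j : Fin 2) → Fin (R j + 1) → ℝ => (Fx (jetInit q), Fu q))
      (𝓝 (fun j _ => φ (x₀, u₀) j)) (𝓝 (x₀, u₀)) := by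
    refine Filter.Tendsto.prodMk_nhds ?_ ?_
    · have h1 := H.par.smooth_x.continuousAt
      rw [ContinuousAt, H.par.state_equilibrium H.sys] at h1
      exact h1.comp (continuous_jetInit.tendsto' _ _ rfl)
    · have h1 := H.par.smooth_u.continuousAt
      rwa [ContinuousAt, H.par.input_equilibrium H.sys] at h1
  filter_upwards [H.par.shiftOfInput_eq H.sys H.out H.deg hlt,
    hcont.eventually H.trans.left_inv] with q h1 h2
  rw [prolongedInput, extendedChain_prolongedState]
  rw [outputInputMap, h1] at h2
  exact h2

/-- The prolongation acts as a shift on the jets of the flat output. -/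
theorem prolongation_jet (H : IsRegularProlongation f x₀ u₀ φ R Fx Fu ρ d i Φ) :
    ∀ᶠ q in 𝓝 (fun j _ => φ (x₀, u₀) j),
      prolongation f Φ d (prolongedState Fx H.order (jetInit q), prolongedControl Fu i q)
        = prolongedState Fx H.order (jetTail q) := by
  filter_upwards [H.prolongedInput_eq, H.par.state_shift H.sys H.out] with q h1 h2
  rw [prolongation_eq, h1]
  refine Prod.ext h2.symm (funext fun k => ?_)
  exact extendedChain_prolongedState H.order q k.succ

/-- By `prolongedInput_eq`, `Fu` factors through the prolonged state and control. When only `y²_[R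
1]` varies, the component `uⁱ` of the control is all that moves there; with derivative zero it would
make the derivative of the whole `Fu` vanish, against `reg`. -/
theorem fderiv_input_ne_zero (H : IsRegularProlongation f x₀ u₀ φ R Fx Fu ρ d i Φ) :
    fderiv ℝ Fu (fun j _ => φ (x₀, u₀) j) (Pi.single 1 (Pi.single (Fin.last (R 1)) 1)) i ≠ 0 := by
  intro h0
  set q₀ : (j : Fin 2) → Fin (R j + 1) → ℝ := fun j _ => φ (x₀, u₀) j
  have hFu := H.par.hasDerivAt_topLine 1
  have hw : HasDerivAt (fun t => prolongedControl Fu i (topLine q₀ 1 t)) 0 0 := by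
    refine hasDerivAt_pi.2 (Fin.forall_fin_two.2 ⟨?_, ?_⟩)
    · have h1 : ∀ t, topLine q₀ 1 t 0 (Fin.last (R 0)) = q₀ 0 (Fin.last (R 0)) := fun t =>
        topLine_of_ne q₀ t fun h => absurd h zero_ne_one
      simp only [prolongedControl, Matrix.cons_val_zero, h1]
      exact hasDerivAt_const _ _
    · have h1 := hasDerivAt_pi.1 hFu i
      rw [h0] at h1
      exact h1
  have hp := H.smoothNear_prolongedInput.hasStrictFDerivAt.hasFDerivAt
  have hbase : (prolongedState Fx H.order (jetInit q₀), prolongedControl Fu i (topLine q₀ 1 0))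
      = ((x₀, fun _ => outputInputMap f u₀ φ ρ i (x₀, u₀) 0),
        outputInputMap f u₀ φ ρ i (x₀, u₀)) := by
    rw [topLine_zero]
    exact Prod.ext H.prolongedState_equilibrium H.prolongedControl_equilibrium
  rw [← hbase] at hp
  have hz : HasDerivAt (fun _ : ℝ => prolongedState Fx H.order (jetInit q₀)) 0 0 :=
    hasDerivAt_const _ _
  have h1 := HasFDerivAt.comp_hasDerivAt (f := fun t =>
    (prolongedState Fx H.order (jetInit q₀), prolongedControl Fu i (topLine q₀ 1 t)))
    (0 : ℝ) hp (hz.prodMk hw)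
  have h2 : (fun t => Fu (topLine q₀ 1 t)) =ᶠ[𝓝 0] (prolongedInput Φ d ∘ fun t =>
      (prolongedState Fx H.order (jetInit q₀), prolongedControl Fu i (topLine q₀ 1 t))) := by
    filter_upwards [(tendsto_topLine q₀ 1).eventually H.prolongedInput_eq] with t ht
    rw [← ht, jetInit_topLine]
    rfl
  have h3 := hFu.unique (h1.congr_of_eventuallyEq h2)
  refine H.reg (h3.trans ?_)
  exact map_zero _

/-- The lower shifts of the flat output and the input of the prolongation are independent: a
property of jets near the equilibrium that only involves these holds for all values of them. -/
theorem eventually_init_control (H : IsRegularProlongation f x₀ u₀ φ R Fx Fu ρ d i Φ)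
    {p : ((j : Fin 2) → Fin (R j) → ℝ) × (Fin 2 → ℝ) → Prop}
    (hp : ∀ᶠ q in 𝓝 (fun j _ => φ (x₀, u₀) j), p (jetInit q, prolongedControl Fu i q)) :
    ∀ᶠ r in 𝓝 ((fun j _ => φ (x₀, u₀) j), outputInputMap f u₀ φ ρ i (x₀, u₀)), p r := by
  set q₀ : (j : Fin 2) → Fin (R j + 1) → ℝ := fun j _ => φ (x₀, u₀) j
  let A : ((j : Fin 2) → Fin (R j + 1) → ℝ) →L[ℝ] ((j : Fin 2) → Fin (R j) → ℝ) :=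
    ContinuousLinearMap.pi fun j => ContinuousLinearMap.pi fun k =>
      (ContinuousLinearMap.proj (R := ℝ) (φ := fun _ : Fin (R j + 1) => ℝ) k.castSucc).comp
        (ContinuousLinearMap.proj j)
  let B : ((j : Fin 2) → Fin (R j + 1) → ℝ) →L[ℝ] (Fin 2 → ℝ) := ContinuousLinearMap.pi
    ![(ContinuousLinearMap.proj (R := ℝ) (φ := fun _ : Fin (R 0 + 1) => ℝ) (Fin.last (R 0))).comp
        (ContinuousLinearMap.proj 0),
      (ContinuousLinearMap.proj (R := ℝ) (φ := fun _ : Fin 2 => ℝ) i).comp (fderiv ℝ Fu q₀)]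
  have hB : HasStrictFDerivAt (prolongedControl Fu i) B q₀ := by
    refine hasStrictFDerivAt_pi.2 (Fin.forall_fin_two.2 ⟨?_, ?_⟩)
    · exact ContinuousLinearMap.hasStrictFDerivAt
        ((ContinuousLinearMap.proj (R := ℝ) (φ := fun _ : Fin (R 0 + 1) => ℝ)
          (Fin.last (R 0))).comp
          (ContinuousLinearMap.proj (φ := fun j : Fin 2 => Fin (R j + 1) → ℝ) 0))
    · exact hasStrictFDerivAt_pi'.1 H.par.smooth_u.hasStrictFDerivAt i
  have hΩ := (A.hasStrictFDerivAt (x := q₀)).prodMk hB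
  have hsurj : (A.prod B).range = ⊤ := by
    rw [LinearMap.range_eq_top]
    rintro ⟨y, b⟩
    set e : (j : Fin 2) → Fin (R j + 1) → ℝ := Pi.single 1 (Pi.single (Fin.last (R 1)) 1)
    have he : fderiv ℝ Fu q₀ e i ≠ 0 := H.fderiv_input_ne_zero
    have hAe : ∀ t : ℝ, ∀ q, A (q + t • e) = A q := fun t q => jetInit_topLine q 1 t
    have hAs : ∀ v, A (jetSnoc (y, v)) = y := fun v => jetInit_jetSnoc (y, v)
    have he0 : e 0 (Fin.last (R 0)) = 0 := by simp [e]
    have hB0 : ∀ q, B q 0 = q 0 (Fin.last (R 0)) := fun q => rfl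
    have hB1 : ∀ q, B q 1 = fderiv ℝ Fu q₀ q i := fun q => rfl
    set q := jetSnoc (y, b)
    -- The direction `e` changes neither the lower jet nor `y¹_[R 0]`, so it is free to adjust the
    -- remaining component `uⁱ`.
    refine ⟨q + ((b 1 - fderiv ℝ Fu q₀ q i) / fderiv ℝ Fu q₀ e i) • e, ?_⟩
    refine Prod.ext ((hAe _ q).trans (hAs b)) (funext (Fin.forall_fin_two.2 ⟨?_, ?_⟩))
    · refine (hB0 _).trans ?_
      simp only [Pi.add_apply, Pi.smul_apply, he0, smul_zero, add_zero]
      exact jetSnoc_last (y, b) 0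
    · refine (hB1 _).trans ?_
      simp only [map_add, map_smul, Pi.add_apply, Pi.smul_apply, smul_eq_mul]
      field_simp
      ring
  have hmap := hΩ.map_nhds_eq_of_surj hsurj
  rw [← H.prolongedControl_equilibrium]
  refine Filter.Eventually.filter_mono (hmap.ge) ?_
  exact hp

/-- The shifts of the flat output can be recovered from the state of the prolongation. -/
theorem closedLoopJet_prolongedState (H : IsRegularProlongation f x₀ u₀ φ R Fx Fu ρ d i Φ) :
    ∀ᶠ y in 𝓝 (fun j _ => φ (x₀, u₀) j),
      closedLoopJet f φ R Φ d (outputInputMap f u₀ φ ρ i (x₀, u₀)) (prolongedState Fx H.order y)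
        = y := by
  set w := outputInputMap f u₀ φ ρ i (x₀, u₀)
  -- Since the lower jet and the control are independent, the control may be set to `w` without
  -- constraining the lower jet.
  have hspec : ∀ {p : ((j : Fin 2) → Fin (R j) → ℝ) → Prop},
      (∀ᶠ q in 𝓝 (fun j _ => φ (x₀, u₀) j), prolongedControl Fu i q = w → p (jetInit q)) →
      ∀ᶠ y in 𝓝 (fun j _ => φ (x₀, u₀) j), p y := by
    intro p hp
    have h1 := H.eventually_init_control (p := fun r => r.2 = w → p r.1) hp
    have h2 : Filter.Tendsto (fun y : (j : Fin 2) → Fin (R j) → ℝ => (y, w))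
        (𝓝 (fun j _ => φ (x₀, u₀) j)) (𝓝 ((fun j _ => φ (x₀, u₀) j), w)) :=
      Continuous.tendsto' (by fun_prop) _ _ rfl
    filter_upwards [h2.eventually h1] with y hy using hy rfl
  have hk : ∀ k : ℕ, ∀ᶠ y in 𝓝 (fun j _ => φ (x₀, u₀) j), ∀ (j : Fin 2) (hj : k < R j),
      φ (((closedLoop f Φ d w)^[k] (prolongedState Fx H.order y)).1,
        prolongedInput Φ d ((closedLoop f Φ d w)^[k] (prolongedState Fx H.order y), w)) j
        = y j ⟨k, hj⟩ := by
    intro k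
    induction k with
    | zero =>
      refine hspec ?_
      filter_upwards [H.prolongedInput_eq, H.par.output_eq H.sys H.out] with q h1 h2 hw j hj
      rw [hw] at h1
      rw [Function.iterate_zero, id_eq, h1]
      exact h2 j
    | succ k ih =>
      refine hspec ?_
      have htail : Filter.Tendsto (jetTail (R := R)) (𝓝 (fun j _ => φ (x₀, u₀) j))
          (𝓝 (fun j _ => φ (x₀, u₀) j)) := continuous_jetTail.tendsto' _ _ rfl
      -- One closed-loop step replaces the lower jet by the tail, whose entry of order `k` is the
      -- original entry of order `k + 1`.
      filter_upwards [H.prolongation_jet, htail.eventually ih] with q h1 h2 hw j hj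
      rw [hw] at h1
      rw [Function.iterate_succ_apply, closedLoop, h1]
      exact h2 j (by omega)
  filter_upwards [Filter.eventually_all.2 fun j => Filter.eventually_all.2 fun k : Fin (R j) =>
    hk k] with y hy
  funext j k
  exact hy j k j k.2

theorem closedLoopJet_equilibrium (H : IsRegularProlongation f x₀ u₀ φ R Fx Fu ρ d i Φ) :
    closedLoopJet f φ R Φ d (outputInputMap f u₀ φ ρ i (x₀, u₀))
      (x₀, fun _ => outputInputMap f u₀ φ ρ i (x₀, u₀) 0) = fun j _ => φ (x₀, u₀) j := by
  have h := H.closedLoopJet_prolongedState.self_of_nhds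
  rwa [H.prolongedState_equilibrium] at h

theorem isLocalDiffeoNear_closedLoopJet
    (H : IsRegularProlongation f x₀ u₀ φ R Fx Fu ρ d i Φ) :
    IsLocalDiffeoNear (closedLoopJet f φ R Φ d (outputInputMap f u₀ φ ρ i (x₀, u₀)))
      (x₀, fun _ => outputInputMap f u₀ φ ρ i (x₀, u₀) 0) := by
  refine ⟨H.smoothNear_closedLoopJet, prolongedState Fx H.order, ?_,
    H.prolongedState_closedLoopJet, ?_⟩
  · rw [H.closedLoopJet_equilibrium]; exact H.smoothNear_prolongedState
  · rw [H.closedLoopJet_equilibrium]; exact H.closedLoopJet_prolongedState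

/-- The state of the prolongation and the lower jet are locally diffeomorphic, so their dimensions
agree. -/
theorem dimension_eq (H : IsRegularProlongation f x₀ u₀ φ R Fx Fu ρ d i Φ) :
    n + d = R 0 + R 1 := by
  have h := H.isLocalDiffeoNear_closedLoopJet.finrank_eq
  simpa [Module.finrank_pi_fintype, Fin.sum_univ_two] using h

theorem isStaticFeedbackLinearizable (H : IsRegularProlongation f x₀ u₀ φ R Fx Fu ρ d i Φ) :
    IsStaticFeedbackLinearizable (prolongation f Φ d)
      (x₀, fun _ => outputInputMap f u₀ φ ρ i (x₀, u₀) 0)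
      (outputInputMap f u₀ φ ρ i (x₀, u₀)) := by
  have hpos : ∀ j, 0 < R j := H.par.order_pos H.sys H.out
  have hT₀ := H.closedLoopJet_equilibrium
  have hTdiff := H.isLocalDiffeoNear_closedLoopJet
  have hTG := H.closedLoopJet_prolongedState
  have hTs := H.smoothNear_closedLoopJet
  have hgs := H.smoothNear_prolongation
  have hg₀ := H.prolongation_equilibrium
  have hG₀ := H.prolongedState_equilibrium
  have hu₀ := H.prolongedControl_equilibrium
  set w₀ := outputInputMap f u₀ φ ρ i (x₀, u₀)
  set T := closedLoopJet f φ R Φ d w₀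
  set z₀ : (Fin n → ℝ) × (Fin d → ℝ) := (x₀, fun _ => w₀ 0)
  -- The feedback is the end of each chain one step later; a last index exists by `order_pos`.
  let V : ((Fin n → ℝ) × (Fin d → ℝ)) × (Fin 2 → ℝ) → Fin 2 → ℝ := fun p j =>
    T (prolongation f Φ d p) j ⟨R j - 1, Nat.sub_lt (hpos j) one_pos⟩
  -- Candidate inverse of `(T, V)`: lower shifts and highest shifts together form a full jet, which
  -- determines state and control. One composition is computed in `hinv`; equality of dimensions
  -- supplies the other.
  let Θ : ((j : Fin 2) → Fin (R j) → ℝ) × (Fin 2 → ℝ) →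
      ((Fin n → ℝ) × (Fin d → ℝ)) × (Fin 2 → ℝ) := fun r =>
    (prolongedState Fx H.order r.1, prolongedControl Fu i (jetSnoc r))
  let r₀ : ((j : Fin 2) → Fin (R j) → ℝ) × (Fin 2 → ℝ) :=
    ((fun j _ => φ (x₀, u₀) j), fun j => φ (x₀, u₀) j)
  have hsnoc₀ : jetSnoc r₀ = fun j _ => φ (x₀, u₀) j := by
    funext j k
    refine Fin.lastCases ?_ (fun k => ?_) k
    · simp [jetSnoc, r₀]
    · simp [jetSnoc, r₀]
  have hTg : SmoothNear (fun p => T (prolongation f Φ d p)) (z₀, w₀) := hTs.comp hgs hg₀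
  have hV : SmoothNear V (z₀, w₀) := SmoothNear.pi fun j => by
    filter_upwards [hTg] with p hp using contDiffAt_pi.1 (contDiffAt_pi.1 hp j) _
  have hΞ : SmoothNear (fun p : ((Fin n → ℝ) × (Fin d → ℝ)) × (Fin 2 → ℝ) => (T p.1, V p))
      (z₀, w₀) := (hTs.comp (contDiff_fst.smoothNear _) rfl).prodMk hV
  have hΘ : SmoothNear Θ r₀ :=
    (H.smoothNear_prolongedState.comp (contDiff_fst.smoothNear _) rfl).prodMk
      (H.smoothNear_prolongedControl.comp (contDiff_jetSnoc.smoothNear _) hsnoc₀)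
  have hΘ₀ : Θ r₀ = (z₀, w₀) := Prod.ext hG₀ ((congrArg _ hsnoc₀).trans hu₀)
  have hsnoc : Filter.Tendsto (jetSnoc (R := R)) (𝓝 r₀) (𝓝 fun j _ => φ (x₀, u₀) j) :=
    contDiff_jetSnoc.continuous.tendsto' _ _ hsnoc₀
  have hfst : Filter.Tendsto (Prod.fst : ((j : Fin 2) → Fin (R j) → ℝ) × (Fin 2 → ℝ) → _)
      (𝓝 r₀) (𝓝 fun j _ => φ (x₀, u₀) j) := continuous_fst.tendsto' _ _ rfl
  have htail : Filter.Tendsto (jetTail (R := R)) (𝓝 (fun j _ => φ (x₀, u₀) j))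
      (𝓝 (fun j _ => φ (x₀, u₀) j)) := continuous_jetTail.tendsto' _ _ rfl
  have hstep : ∀ᶠ r in 𝓝 r₀, T (prolongation f Φ d (Θ r)) = jetTail (jetSnoc r) := by
    filter_upwards [hsnoc.eventually H.prolongation_jet, (htail.comp hsnoc).eventually hTG]
      with r h1 h2
    rw [jetInit_jetSnoc] at h1
    rw [h1]
    exact h2
  have hinv : ∀ᶠ r in 𝓝 r₀, (T (Θ r).1, V (Θ r)) = r := by
    filter_upwards [hstep, hfst.eventually hTG] with r h1 h2
    refine Prod.ext h2 (funext fun j => ?_)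
    simp only [V, h1, jetTail]
    rw [← jetSnoc_last r j]
    refine congrArg (jetSnoc r j) (Fin.ext ?_)
    have := hpos j
    simp only [Fin.val_succ, Fin.val_last]
    omega
  have hdim : Module.finrank ℝ (((j : Fin 2) → Fin (R j) → ℝ) × (Fin 2 → ℝ))
      = Module.finrank ℝ (((Fin n → ℝ) × (Fin d → ℝ)) × (Fin 2 → ℝ)) := by
    rw [Module.finrank_prod, Module.finrank_prod, hTdiff.finrank_eq]
  obtain ⟨hdiff, hright⟩ := isLocalDiffeoNear_of_leftInverse hdim hΘ hΞ hΘ₀ hinv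
  refine ⟨R, hpos, T, V, hTdiff, hdiff, ?_⟩
  have hΞ₀ : (T z₀, V (z₀, w₀)) = r₀ := by
    rw [← hinv.self_of_nhds, hΘ₀]
  have hΞt : Filter.Tendsto (fun p : ((Fin n → ℝ) × (Fin d → ℝ)) × (Fin 2 → ℝ) => (T p.1, V p))
      (𝓝 (z₀, w₀)) (𝓝 r₀) := by
    have := hΞ.continuousAt
    rwa [ContinuousAt, hΞ₀] at this
  -- Every nearby point is `Θ` of its own coordinates `(T p.1, V p)`, so the jet shift `hstep`
  -- becomes the Brunovsky form.
  filter_upwards [hΞt.eventually hstep, hright] with p h1 h2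
  rw [h2] at h1
  funext j k
  by_cases hk : (k : ℕ) + 1 < R j
  · rw [brunovsky, dif_pos hk, h1]
    exact congrFun (congrFun (jetInit_jetSnoc (T p.1, V p)) j) ⟨k + 1, hk⟩
  · rw [brunovsky, dif_neg hk]
    refine congrArg (T (prolongation f Φ d p) j) (Fin.ext ?_)
    have := k.2
    simp only
    omega

end IsRegularProlongation

end Prolongation

/-! ### The main theorem -/

theorem mainTheorem3 {n : ℕ} (f : (Fin n → ℝ) × (Fin 2 → ℝ) → (Fin n → ℝ))
    (x₀ : Fin n → ℝ) (u₀ : Fin 2 → ℝ) (hf : IsDiscreteSystem f x₀ u₀)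
    (φ : (Fin n → ℝ) × (Fin 2 → ℝ) → (Fin 2 → ℝ)) (hφ : IsForwardFlatOutput f x₀ u₀ φ)
    (R : Fin 2 → ℕ) (hR : IsLeast (shiftOrders f x₀ u₀ φ) R)
    (Fx : ((j : Fin 2) → Fin (R j) → ℝ) → (Fin n → ℝ))
    (Fu : ((j : Fin 2) → Fin (R j + 1) → ℝ) → (Fin 2 → ℝ))
    (hF : IsParametrization f x₀ u₀ φ R Fx Fu)
    (ρ : ℕ) (hρ : HasRelativeDegree f x₀ u₀ (fun p => φ p 0) ρ)
    (hreg : fderiv ℝ Fu (fun j _ => φ (x₀, u₀) j)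
      (Pi.single 1 (Pi.single (Fin.last (R 1)) 1)) ≠ 0) :
    ∃ d : ℕ, n + d = R 0 + R 1 ∧ ρ + d = R 0 ∧
      (∃ (i : Fin 2) (Φ : (Fin n → ℝ) × (Fin 2 → ℝ) → (Fin 2 → ℝ)),
        IsInputTransformation x₀ u₀ (outputInputMap f u₀ φ ρ i) Φ) ∧
      ∀ (i : Fin 2) (Φ : (Fin n → ℝ) × (Fin 2 → ℝ) → (Fin 2 → ℝ)),
        IsInputTransformation x₀ u₀ (outputInputMap f u₀ φ ρ i) Φ →
        IsStaticFeedbackLinearizable (prolongation f Φ d)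
          (x₀, fun _ => outputInputMap f u₀ φ ρ i (x₀, u₀) 0)
          (outputInputMap f u₀ φ ρ i (x₀, u₀)) := by
  have hd : ρ + (R 0 - ρ) = R 0 := Nat.add_sub_cancel' (hF.relativeDegree_le hf hφ.1 hρ)
  have hex := hρ.exists_isInputTransformation hf hφ.1
  have H : ∀ {i Φ}, IsInputTransformation x₀ u₀ (outputInputMap f u₀ φ ρ i) Φ →
      IsRegularProlongation f x₀ u₀ φ R Fx Fu ρ (R 0 - ρ) i Φ :=
    fun hΦ => ⟨hf, hφ.1, hF, hρ, hreg, hΦ, hd⟩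
  refine ⟨R 0 - ρ, ?_, hd, hex, fun i Φ hΦ => (H hΦ).isStaticFeedbackLinearizable⟩
  -- The dimension formula does not mention the input transformation, so any one that exists
  -- suffices to derive it.
  obtain ⟨i, Φ, hΦ⟩ := hex
  exact (H hΦ).dimension_eq
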